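/- **Languages.** Fix a first-order signature of function symbols (constants included) and predicate letters. *Ordinary terms* are built from variables and function symbols. Formulas are taken up to renaming of bound variables, and $A^x_t$ is the (capture-free) result of putting $t$ for the free $x$ in $A$. Both languages have atomic formulas $P t_1\ldots t_n$, $t_1=t_2$ and $\exists!t$ ("$t$ exists"), and $\bot,\land,\lor,\rightarrow,\forall,\exists$; $\neg A$ is $A\rightarrow\bot$, and $A\leftrightarrow B$ is $(A\rightarrow B)\land(B\rightarrow A)$. The language of $\mathbf{INF}^\iota$ has only ordinary terms, and in addition the formulas $\iota x[F,G]$ ("the $F$ is $G$"), where $\iota$ binds $x$ in $F$ and $G$. The language of $\mathbf{INF}^{LL\Delta}$ has in addition the terms $\iota xA$ ("the $A$") and the formulas $\Delta xB,t$ (the predicate abstract of $B$ applied to $t$); in it the $\iota$ terms may stand left or right of $=$, as $t$ in $\Delta xB,t$, and as $t$ in $\exists!t$, but not as arguments of predicate letters or function symbols. **Intuitionist negative free logic $\mathbf{INF}$** is the natural deduction system with the usual intuitionist introduction and elimination rules for $\land,\lor,\rightarrow$, and with: - $\bot E$: from $\bot$ infer any atomic formula. - $\forall I$: infer $\forall xA$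 from a deduction of $A^x_y$ that may discharge $\exists!y$. $\forall E$: from $\forall xA$ and $\exists!t$ infer $A^x_t$. - $\exists I$: from $A^x_t$ and $\exists!t$ infer $\exists xA$. $\exists E$: from $\exists xA$ and a deduction of $C$ that may discharge $A^x_y$ and $\exists!y$, infer $C$. - ${=}I$: from $\exists!t$ infer $t=t$. ${=}E$: from $t_1=t_2$ and $A^x_{t_1}$, with $A$ atomic, infer $A^x_{t_2}$. - $AD$: from $Pt_1\ldots t_n$ infer $\exists!t_i$, and from $t_1=t_2$ infer $\exists!t_1$ and $\exists!t_2$. Here and below, the variable $y$ (or $z$) of a subdeduction with discharged assumptions must be fresh: not free in the formula inferred, in the other formulas of the rule, or in any undischarged assumption of that subdeduction. **$\mathbf{INF}^\iota$** is $\mathbf{INF}$ in its language with the rules: - $\iota I$: from $F^x_t$, $G^x_t$, $\exists!t$ and a deduction of $z=t$ that may discharge $F^x_z$ and $\exists!z$, infer $\iota x[F,G]$. - $\iota E^1$: from $\iota x[F,G]$ and a deduction of $C$ that may discharge $F^x_z$, $G^x_z$ and $\exists!z$, infer $C$. - $\iota E^2$: from $\iota x[F,G]$, $\exists!t_1$,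 $\exists!t_2$, $F^x_{t_1}$ and $F^x_{t_2}$ infer $t_1=t_2$. **$\mathbf{INF}^{LL\Delta}$** is $\mathbf{INF}$ in its language (the terms in the rules of $\mathbf{INF}$ may be $\iota$ terms, as long as the results of substitution are formulas of the language) with all instances of the following axioms: - $LL$: $\forall y(\iota xF=y\leftrightarrow\forall x(F\leftrightarrow x=y))$; - $\Delta t$: $\Delta xB,t\leftrightarrow(\exists!t\land B^x_t)$, where $B^x_t$ is a formula of the language; - $\Delta\iota$: $\Delta xB,\iota xA\leftrightarrow\exists z(\iota xA=z\land B^x_z)$, with $z$ not free in $A$ or in $\Delta xB$. In each system $\Gamma\vdash A$ means that there is a deduction of $A$ all of whose undischarged assumptions belong to the (possibly infinite) set $\Gamma$. **Translations.** $\tau$, from the language of $\mathbf{INF}^{LL\Delta}$ to that of $\mathbf{INF}^\iota$, leaves atomic formulas without $\iota$ terms and $\bot$ unchanged, commutes with $\land,\lor,\rightarrow,\forall,\exists$, and, for an ordinary term $t$ in which $x$ is not free, has $\tau(\iota xA=t)=\iota x[\tau(A),x=t]$, $\tau(t=\iota xA)=\iota x[\tau(A),t=x]$, $\tau(\iota xA=\iota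 yB)=\iota x[\tau(A),\iota y[\tau(B),x=y]]$ (with $x\neq y$, $x$ not free in $B$), $\tau(\exists!\iota xA)=\iota x[\tau(A),\exists!x]$, $\tau(\Delta xB,t)=\iota x[t=x,\tau(B)]$ and $\tau(\Delta xB,\iota xA)=\iota x[\tau(A),\tau(B)]$. $\upsilon$, in the opposite direction, leaves atomic formulas and $\bot$ unchanged, commutes with $\land,\lor,\rightarrow,\forall,\exists$, and has $\upsilon(\iota x[A,B])=\Delta x\,\upsilon(B),\iota x\,\upsilon(A)$. For a set $\Gamma$ of formulas, $\tau(\Gamma)$ and $\upsilon(\Gamma)$ are the sets of the translations of its members. **Theorem 2.** $\mathbf{INF}^\iota$ and $\mathbf{INF}^{LL\Delta}$ are equivalent: for all sets $\Gamma$ of formulas and all formulas $A$ of the respective language, (a) if $\Gamma\vdash A$ in $\mathbf{INF}^\iota$, then $\upsilon(\Gamma)\vdash\upsilon(A)$ in $\mathbf{INF}^{LL\Delta}$; (b) if $\Gamma\vdash A$ in $\mathbf{INF}^{LL\Delta}$, then $\tau(\Gamma)\vdash\tau(A)$ in $\mathbf{INF}^\iota$. -/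

import Mathlib

/-!
Syntax with de Bruijn indices: variables are natural numbers, every binder binds index `0` and
raises the other indices by one. Formulas are thus taken up to renaming of bound variables, and
`A.inst t` is `A` with `t` put for the variable bound by the outermost binder, without capture.
-/

universe u v

namespace FreeLogic


/-- A renaming of variables, carried under one binder. -/
def liftRen (ρ : ℕ → ℕ) : ℕ → ℕ
  | 0 => 0
  | n + 1 => ρ n + 1

section Quantifier

/-- Formulas of the language with the binary quantifier `iota F G`, "the `F` is `G`"; it binds one
variable in both `F` and `G`. The formula `exi t` says that `t` exists. -/
inductive IForm (L : FirstOrder.Language.{u, v}) : Type (max u v)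
  | falsum : IForm L
  | rel {n : ℕ} (R : L.Relations n) (ts : Fin n → L.Term ℕ) : IForm L
  | exi (t : L.Term ℕ) : IForm L
  | eq (s t : L.Term ℕ) : IForm L
  | and (A B : IForm L) : IForm L
  | or (A B : IForm L) : IForm L
  | imp (A B : IForm L) : IForm L
  | all (A : IForm L) : IForm L
  | ex (A : IForm L) : IForm L
  | iota (F G : IForm L) : IForm L

variable {L : FirstOrder.Language.{u, v}}

/-- A term moved under one binder. -/
def tshift (t : L.Term ℕ) : L.Term ℕ := t.relabel Nat.succ

/-- A substitution of terms for variables, carried under one binder. -/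
def liftSub (σ : ℕ → L.Term ℕ) : ℕ → L.Term ℕ
  | 0 => FirstOrder.Language.Term.var 0
  | n + 1 => tshift (σ n)

/-- The substitution that puts `t` for the variable of the removed binder. -/
def single (t : L.Term ℕ) : ℕ → L.Term ℕ
  | 0 => t
  | n + 1 => FirstOrder.Language.Term.var n

namespace IForm

/-- Renaming of free variables. -/
def rename : (ℕ → ℕ) → IForm L → IForm L
  | _, falsum => falsum
  | ρ, rel R ts => rel R fun i => (ts i).relabel ρ
  | ρ, exi t => exi (t.relabel ρ)
  | ρ, eq s t => eq (s.relabel ρ) (t.relabel ρ)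
  | ρ, and A B => and (rename ρ A) (rename ρ B)
  | ρ, or A B => or (rename ρ A) (rename ρ B)
  | ρ, imp A B => imp (rename ρ A) (rename ρ B)
  | ρ, all A => all (rename (liftRen ρ) A)
  | ρ, ex A => ex (rename (liftRen ρ) A)
  | ρ, iota F G => iota (rename (liftRen ρ) F) (rename (liftRen ρ) G)

/-- A formula moved under one binder (whose variable is then not free in it). -/
def shift (A : IForm L) : IForm L := A.rename Nat.succ

/-- Simultaneous substitution of terms for the free variables. -/
def subst : (ℕ → L.Term ℕ) → IForm L → IForm L
  | _, falsum => falsum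
  | σ, rel R ts => rel R fun i => (ts i).subst σ
  | σ, exi t => exi (t.subst σ)
  | σ, eq s t => eq (s.subst σ) (t.subst σ)
  | σ, and A B => and (subst σ A) (subst σ B)
  | σ, or A B => or (subst σ A) (subst σ B)
  | σ, imp A B => imp (subst σ A) (subst σ B)
  | σ, all A => all (subst (liftSub σ) A)
  | σ, ex A => ex (subst (liftSub σ) A)
  | σ, iota F G => iota (subst (liftSub σ) F) (subst (liftSub σ) G)

/-- `A.inst t` is `A` with `t` for `x`, where `x` is the variable with index `0` in `A`. -/
def inst (A : IForm L) (t : L.Term ℕ) : IForm L := A.subst (single t)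

/-- Atomic formulas: predicate letters, identity and the existence predicate. -/
def IsAtomic : IForm L → Prop
  | rel _ _ => True
  | exi _ => True
  | eq _ _ => True
  | _ => False

/-- Negation, by its intuitionist definition. -/
def neg (A : IForm L) : IForm L := imp A falsum

/-- The biconditional. -/
def iff (A B : IForm L) : IForm L := and (imp A B) (imp B A)

end IForm

open IForm in
/-- `IProv Γ A`: there is a natural deduction of `A` from undischarged assumptions in `Γ` in
intuitionist negative free logic with the binary quantifier. A discharged assumption is one that is
inserted into `Γ` in a premise. The eigenvariable of a rule is the variable `0`, which is fresh
because the assumptions and the side formulas are shifted. -/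
inductive IProv : Set (IForm L) → IForm L → Prop
  | ax {Γ : Set (IForm L)} {A : IForm L} : A ∈ Γ → IProv Γ A
  | andI {Γ : Set (IForm L)} {A B : IForm L} : IProv Γ A → IProv Γ B → IProv Γ (and A B)
  | andE1 {Γ : Set (IForm L)} {A B : IForm L} : IProv Γ (and A B) → IProv Γ A
  | andE2 {Γ : Set (IForm L)} {A B : IForm L} : IProv Γ (and A B) → IProv Γ B
  | impI {Γ : Set (IForm L)} {A B : IForm L} : IProv (insert A Γ) B → IProv Γ (imp A B)
  | impE {Γ : Set (IForm L)} {A B : IForm L} : IProv Γ (imp A B) → IProv Γ A → IProv Γ B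
  | orI1 {Γ : Set (IForm L)} {A B : IForm L} : IProv Γ A → IProv Γ (or A B)
  | orI2 {Γ : Set (IForm L)} {A B : IForm L} : IProv Γ B → IProv Γ (or A B)
  | orE {Γ : Set (IForm L)} {A B C : IForm L} :
      IProv Γ (or A B) → IProv (insert A Γ) C → IProv (insert B Γ) C → IProv Γ C
  | falsumE {Γ : Set (IForm L)} {A : IForm L} : A.IsAtomic → IProv Γ falsum → IProv Γ A
  | allI {Γ : Set (IForm L)} {A : IForm L} :
      IProv (insert (exi (FirstOrder.Language.Term.var 0)) (shift '' Γ)) A → IProv Γ (all A)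
  | allE {Γ : Set (IForm L)} {A : IForm L} (t : L.Term ℕ) :
      IProv Γ (all A) → IProv Γ (exi t) → IProv Γ (A.inst t)
  | exI {Γ : Set (IForm L)} {A : IForm L} (t : L.Term ℕ) :
      IProv Γ (A.inst t) → IProv Γ (exi t) → IProv Γ (ex A)
  | exE {Γ : Set (IForm L)} {A C : IForm L} :
      IProv Γ (ex A) →
      IProv (insert A (insert (exi (FirstOrder.Language.Term.var 0)) (shift '' Γ))) C.shift → IProv Γ C
  | eqI {Γ : Set (IForm L)} {t : L.Term ℕ} : IProv Γ (exi t) → IProv Γ (eq t t)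
  | eqE {Γ : Set (IForm L)} {A : IForm L} {s t : L.Term ℕ} : A.IsAtomic →
      IProv Γ (eq s t) → IProv Γ (A.inst s) → IProv Γ (A.inst t)
  | adRel {Γ : Set (IForm L)} {n : ℕ} {R : L.Relations n} {ts : Fin n → L.Term ℕ} (i : Fin n) :
      IProv Γ (rel R ts) → IProv Γ (exi (ts i))
  | adEq1 {Γ : Set (IForm L)} {s t : L.Term ℕ} : IProv Γ (eq s t) → IProv Γ (exi s)
  | adEq2 {Γ : Set (IForm L)} {s t : L.Term ℕ} : IProv Γ (eq s t) → IProv Γ (exi t)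
  | iotaI {Γ : Set (IForm L)} {F G : IForm L} (t : L.Term ℕ) :
      IProv Γ (F.inst t) → IProv Γ (G.inst t) → IProv Γ (exi t) →
      IProv (insert F (insert (exi (FirstOrder.Language.Term.var 0)) (shift '' Γ)))
        (eq (FirstOrder.Language.Term.var 0) (tshift t)) →
      IProv Γ (iota F G)
  | iotaE1 {Γ : Set (IForm L)} {F G C : IForm L} :
      IProv Γ (iota F G) →
      IProv (insert F (insert G (insert (exi (FirstOrder.Language.Term.var 0)) (shift '' Γ)))) C.shift →
      IProv Γ C
  | iotaE2 {Γ : Set (IForm L)} {F G : IForm L} {s t : L.Term ℕ} :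
      IProv Γ (iota F G) → IProv Γ (exi s) → IProv Γ (exi t) →
      IProv Γ (F.inst s) → IProv Γ (F.inst t) → IProv Γ (eq s t)

end Quantifier

section Abstraction

mutual

/-- Individual terms of the language with a term forming `ι`: the ordinary terms, and the `ι` terms
"the `A`", which bind one variable in `A`. -/
inductive DTerm (L : FirstOrder.Language.{u, v}) : Type (max u v)
  | ord (t : L.Term ℕ) : DTerm L
  | iota (A : DForm L) : DTerm L

/-- Formulas of the language with a term forming `ι` and predicate abstraction. Here
`delta B t` is the predicate abstract of `B` (binding one variable in `B`) applied to `t`.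
The `ι` terms stand as sides of an identity, as the subject of a predicate abstract, and as the
subject of the existence predicate, but not as arguments of predicate letters or function
symbols. -/
inductive DForm (L : FirstOrder.Language.{u, v}) : Type (max u v)
  | falsum : DForm L
  | rel {n : ℕ} (R : L.Relations n) (ts : Fin n → L.Term ℕ) : DForm L
  | exi (t : DTerm L) : DForm L
  | eq (s t : DTerm L) : DForm L
  | and (A B : DForm L) : DForm L
  | or (A B : DForm L) : DForm L
  | imp (A B : DForm L) : DForm L
  | all (A : DForm L) : DForm L
  | ex (A : DForm L) : DForm L
  | delta (B : DForm L) (t : DTerm L) : DForm L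

end

variable {L : FirstOrder.Language.{u, v}}

mutual

/-- Renaming of free variables in a term. -/
def DTerm.rename : (ℕ → ℕ) → DTerm L → DTerm L
  | ρ, .ord t => .ord (t.relabel ρ)
  | ρ, .iota A => .iota (DForm.rename (liftRen ρ) A)

/-- Renaming of free variables in a formula. -/
def DForm.rename : (ℕ → ℕ) → DForm L → DForm L
  | _, .falsum => .falsum
  | ρ, .rel R ts => .rel R fun i => (ts i).relabel ρ
  | ρ, .exi t => .exi (DTerm.rename ρ t)
  | ρ, .eq s t => .eq (DTerm.rename ρ s) (DTerm.rename ρ t)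
  | ρ, .and A B => .and (DForm.rename ρ A) (DForm.rename ρ B)
  | ρ, .or A B => .or (DForm.rename ρ A) (DForm.rename ρ B)
  | ρ, .imp A B => .imp (DForm.rename ρ A) (DForm.rename ρ B)
  | ρ, .all A => .all (DForm.rename (liftRen ρ) A)
  | ρ, .ex A => .ex (DForm.rename (liftRen ρ) A)
  | ρ, .delta B t => .delta (DForm.rename (liftRen ρ) B) (DTerm.rename ρ t)

end

/-- A term moved under one binder. -/
def DTerm.shift (t : DTerm L) : DTerm L := t.rename Nat.succ

/-- A formula moved under one binder. -/
def DForm.shift (A : DForm L) : DForm L := A.rename Nat.succ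

/-- The variable `n` as a term. -/
def DTerm.var (n : ℕ) : DTerm L := .ord (FirstOrder.Language.Term.var n)

/-- The ordinary term that `t` is. The value at an `ι` term is a dummy: it can enter a formula only
by substitution into an argument of a predicate letter or function symbol, which the condition
`DForm.Admits` on the rules excludes. -/
def DTerm.toTerm : DTerm L → L.Term ℕ
  | .ord t => t
  | .iota _ => FirstOrder.Language.Term.var 0

/-- A substitution of terms for variables, carried under one binder. -/
def liftDSub (σ : ℕ → DTerm L) : ℕ → DTerm L
  | 0 => DTerm.var 0
  | n + 1 => (σ n).shift

/-- The substitution that puts `t` for the variable of the removed binder. -/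
def dsingle (t : DTerm L) : ℕ → DTerm L
  | 0 => t
  | n + 1 => DTerm.var n

mutual

/-- Simultaneous substitution of terms for the free variables of a term. -/
def DTerm.subst : (ℕ → DTerm L) → DTerm L → DTerm L
  | σ, .ord (.var i) => σ i
  | σ, .ord (.func f ts) => .ord ((FirstOrder.Language.Term.func f ts).subst fun i => (σ i).toTerm)
  | σ, .iota A => .iota (DForm.subst (liftDSub σ) A)

/-- Simultaneous substitution of terms for the free variables of a formula. -/
def DForm.subst : (ℕ → DTerm L) → DForm L → DForm L
  | _, .falsum => .falsum
  | σ, .rel R ts => .rel R fun i => (ts i).subst fun i => (σ i).toTerm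
  | σ, .exi t => .exi (DTerm.subst σ t)
  | σ, .eq s t => .eq (DTerm.subst σ s) (DTerm.subst σ t)
  | σ, .and A B => .and (DForm.subst σ A) (DForm.subst σ B)
  | σ, .or A B => .or (DForm.subst σ A) (DForm.subst σ B)
  | σ, .imp A B => .imp (DForm.subst σ A) (DForm.subst σ B)
  | σ, .all A => .all (DForm.subst (liftDSub σ) A)
  | σ, .ex A => .ex (DForm.subst (liftDSub σ) A)
  | σ, .delta B t => .delta (DForm.subst (liftDSub σ) B) (DTerm.subst σ t)

end

mutual

/-- The variable `n` does not occur inside an argument of a function symbol or predicate letter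
in the term. -/
def DTerm.Iotable : ℕ → DTerm L → Prop
  | _, .ord (.var _) => True
  | n, .ord (.func f ts) => n ∉ (FirstOrder.Language.Term.func f ts).varFinset
  | n, .iota A => DForm.Iotable (n + 1) A

/-- The variable `n` does not occur inside an argument of a function symbol or predicate letter
in the formula, so that `ι` terms may be substituted for it. -/
def DForm.Iotable : ℕ → DForm L → Prop
  | _, .falsum => True
  | n, .rel _ ts => ∀ i, n ∉ (ts i).varFinset
  | n, .exi t => DTerm.Iotable n t
  | n, .eq s t => DTerm.Iotable n s ∧ DTerm.Iotable n t
  | n, .and A B => DForm.Iotable n A ∧ DForm.Iotable n B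
  | n, .or A B => DForm.Iotable n A ∧ DForm.Iotable n B
  | n, .imp A B => DForm.Iotable n A ∧ DForm.Iotable n B
  | n, .all A => DForm.Iotable (n + 1) A
  | n, .ex A => DForm.Iotable (n + 1) A
  | n, .delta B t => DForm.Iotable (n + 1) B ∧ DTerm.Iotable n t

end

namespace DForm

/-- `A.inst t` is `A` with `t` for `x`, where `x` is the variable with index `0` in `A`. -/
def inst (A : DForm L) (t : DTerm L) : DForm L := A.subst (dsingle t)

/-- The result of putting `t` for the variable `0` in `A` is a formula of the language: always if
`t` is an ordinary term, and if `t` is an `ι` term, when that variable stands in `A` only where `ι`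
terms may stand. -/
def Admits (A : DForm L) : DTerm L → Prop
  | .ord _ => True
  | .iota _ => A.Iotable 0

/-- Atomic formulas: predicate letters, identity and the existence predicate. -/
def IsAtomic : DForm L → Prop
  | rel _ _ => True
  | exi _ => True
  | eq _ _ => True
  | _ => False

/-- Negation, by its intuitionist definition. -/
def neg (A : DForm L) : DForm L := imp A falsum

/-- The biconditional. -/
def iff (A B : DForm L) : DForm L := and (imp A B) (imp B A)

/-- Lambert's Law `∀ y (ι x F = y ↔ ∀ x (F ↔ x = y))`; in `F`, index `0` is `x` and `1` is `y`. -/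
def lambert (F : DForm L) : DForm L :=
  all (iff (eq (.iota F) (.var 0)) (all (iff F (eq (.var 0) (.var 1)))))

/-- The abstraction principle `Δ x B, t ↔ (∃! t ∧ B(t))`. -/
def absTerm (B : DForm L) (t : DTerm L) : DForm L :=
  iff (delta B t) (and (exi t) (B.inst t))

/-- The abstraction principle `Δ x B, ι x A ↔ ∃ z (ι x A = z ∧ B(z))`. -/
def absIota (A B : DForm L) : DForm L :=
  iff (delta B (.iota A)) (ex (and (eq (DTerm.shift (.iota A)) (.var 0)) B))

end DForm

open DForm in
/-- `DProv Γ A`: there is a natural deduction of `A` from undischarged assumptions in `Γ` in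
intuitionist negative free logic, over the language with `ι` terms and predicate abstraction, with
Lambert's Law and the two abstraction principles as axioms. -/
inductive DProv : Set (DForm L) → DForm L → Prop
  | ax {Γ : Set (DForm L)} {A : DForm L} : A ∈ Γ → DProv Γ A
  | andI {Γ : Set (DForm L)} {A B : DForm L} : DProv Γ A → DProv Γ B → DProv Γ (and A B)
  | andE1 {Γ : Set (DForm L)} {A B : DForm L} : DProv Γ (and A B) → DProv Γ A
  | andE2 {Γ : Set (DForm L)} {A B : DForm L} : DProv Γ (and A B) → DProv Γ B
  | impI {Γ : Set (DForm L)} {A B : DForm L} : DProv (insert A Γ) B → DProv Γ (imp A B)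
  | impE {Γ : Set (DForm L)} {A B : DForm L} : DProv Γ (imp A B) → DProv Γ A → DProv Γ B
  | orI1 {Γ : Set (DForm L)} {A B : DForm L} : DProv Γ A → DProv Γ (or A B)
  | orI2 {Γ : Set (DForm L)} {A B : DForm L} : DProv Γ B → DProv Γ (or A B)
  | orE {Γ : Set (DForm L)} {A B C : DForm L} :
      DProv Γ (or A B) → DProv (insert A Γ) C → DProv (insert B Γ) C → DProv Γ C
  | falsumE {Γ : Set (DForm L)} {A : DForm L} : A.IsAtomic → DProv Γ falsum → DProv Γ A
  | allI {Γ : Set (DForm L)} {A : DForm L} :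
      DProv (insert (exi (.var 0)) (shift '' Γ)) A → DProv Γ (all A)
  | allE {Γ : Set (DForm L)} {A : DForm L} (t : DTerm L) : A.Admits t →
      DProv Γ (all A) → DProv Γ (exi t) → DProv Γ (A.inst t)
  | exI {Γ : Set (DForm L)} {A : DForm L} (t : DTerm L) : A.Admits t →
      DProv Γ (A.inst t) → DProv Γ (exi t) → DProv Γ (ex A)
  | exE {Γ : Set (DForm L)} {A C : DForm L} :
      DProv Γ (ex A) →
      DProv (insert A (insert (exi (.var 0)) (shift '' Γ))) C.shift → DProv Γ C
  | eqI {Γ : Set (DForm L)} {t : DTerm L} : DProv Γ (exi t) → DProv Γ (eq t t)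
  | eqE {Γ : Set (DForm L)} {A : DForm L} {s t : DTerm L} : A.IsAtomic →
      A.Admits s → A.Admits t →
      DProv Γ (eq s t) → DProv Γ (A.inst s) → DProv Γ (A.inst t)
  | adRel {Γ : Set (DForm L)} {n : ℕ} {R : L.Relations n} {ts : Fin n → L.Term ℕ} (i : Fin n) :
      DProv Γ (rel R ts) → DProv Γ (exi (.ord (ts i)))
  | adEq1 {Γ : Set (DForm L)} {s t : DTerm L} : DProv Γ (eq s t) → DProv Γ (exi s)
  | adEq2 {Γ : Set (DForm L)} {s t : DTerm L} : DProv Γ (eq s t) → DProv Γ (exi t)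
  | lambert {Γ : Set (DForm L)} (F : DForm L) : DProv Γ (DForm.lambert F)
  | absTerm {Γ : Set (DForm L)} (B : DForm L) (t : DTerm L) : B.Admits t →
      DProv Γ (DForm.absTerm B t)
  | absIota {Γ : Set (DForm L)} (A B : DForm L) : DProv Γ (DForm.absIota A B)

end Abstraction

section Translations

variable {L : FirstOrder.Language.{u, v}}

/-- The translation `τ` into the language with the binary quantifier: it is homophonic but for
`∃! ι x A ↦ ι x [A, ∃! x]`, `ι x A = t ↦ ι x [A, x = t]`, `t = ι x A ↦ ι x [A, t = x]`,
`ι x A = ι y B ↦ ι x [A, ι y [B, x = y]]`, `Δ x B, t ↦ ι x [t = x, B]`, and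
`Δ x B, ι x A ↦ ι x [A, B]`. -/
def tau : DForm L → IForm L
  | .falsum => .falsum
  | .rel R ts => .rel R ts
  | .exi (.ord t) => .exi t
  | .exi (.iota A) => .iota (tau A) (.exi (FirstOrder.Language.Term.var 0))
  | .eq (.ord s) (.ord t) => .eq s t
  | .eq (.iota A) (.ord t) => .iota (tau A) (.eq (FirstOrder.Language.Term.var 0) (tshift t))
  | .eq (.ord s) (.iota B) => .iota (tau B) (.eq (tshift s) (FirstOrder.Language.Term.var 0))
  | .eq (.iota A) (.iota B) =>
      .iota (tau A) (.iota ((tau B).rename (liftRen Nat.succ))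
        (.eq (FirstOrder.Language.Term.var 1) (FirstOrder.Language.Term.var 0)))
  | .and A B => .and (tau A) (tau B)
  | .or A B => .or (tau A) (tau B)
  | .imp A B => .imp (tau A) (tau B)
  | .all A => .all (tau A)
  | .ex A => .ex (tau A)
  | .delta B (.ord t) => .iota (.eq (tshift t) (FirstOrder.Language.Term.var 0)) (tau B)
  | .delta B (.iota A) => .iota (tau A) (tau B)

/-- The translation `υ` into the language with `ι` terms and predicate abstraction: it is
homophonic but for `ι x [A, B] ↦ Δ x B, ι x A`. -/
def upsilon : IForm L → DForm L
  | .falsum => .falsum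
  | .rel R ts => .rel R ts
  | .exi t => .exi (.ord t)
  | .eq s t => .eq (.ord s) (.ord t)
  | .and A B => .and (upsilon A) (upsilon B)
  | .or A B => .or (upsilon A) (upsilon B)
  | .imp A B => .imp (upsilon A) (upsilon B)
  | .all A => .all (upsilon A)
  | .ex A => .ex (upsilon A)
  | .iota A B => .delta (upsilon B) (.iota (upsilon A))

end Translations

end FreeLogic

namespace FreeLogic

open FirstOrder.Language (Term)

section TermLemmas

variable {L : FirstOrder.Language.{u, v}}

theorem term_relabel_eq_subst (ρ : ℕ → ℕ) (t : L.Term ℕ) :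
    t.relabel ρ = t.subst fun i => Term.var (ρ i) := by
  induction t with
  | var i => rfl
  | func f ts ih => simp only [Term.relabel, Term.subst, ih]

theorem term_subst_subst (σ τ : ℕ → L.Term ℕ) (t : L.Term ℕ) :
    (t.subst σ).subst τ = t.subst fun i => (σ i).subst τ := by
  induction t with
  | var i => rfl
  | func f ts ih => simp only [Term.subst, ih]

theorem term_subst_var (t : L.Term ℕ) : t.subst Term.var = t := by
  induction t with
  | var i => rfl
  | func f ts ih => simp only [Term.subst, ih]

theorem term_subst_congr {σ τ : ℕ → L.Term ℕ} (t : L.Term ℕ)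
    (h : ∀ i ∈ t.varFinset, σ i = τ i) : t.subst σ = t.subst τ := by
  induction t with
  | var i => exact h i (by simp [Term.varFinset])
  | func f ts ih =>
    simp only [Term.subst]
    congr 1
    funext k
    exact ih k fun i hi => h i (by simpa [Term.varFinset] using ⟨k, hi⟩)

theorem tshift_eq_subst (t : L.Term ℕ) : tshift t = t.subst fun i => Term.var (i + 1) :=
  term_relabel_eq_subst _ t

theorem tshift_subst_single (s t : L.Term ℕ) : (tshift t).subst (single s) = t := by
  rw [tshift_eq_subst, term_subst_subst]
  exact term_subst_var t

theorem tshift_relabel_liftRen (ρ : ℕ → ℕ) (t : L.Term ℕ) :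
    (tshift t).relabel (liftRen ρ) = tshift (t.relabel ρ) := by
  simp only [tshift_eq_subst, term_relabel_eq_subst, term_subst_subst]
  rfl

theorem tshift_subst_liftSub (σ : ℕ → L.Term ℕ) (t : L.Term ℕ) :
    (tshift t).subst (liftSub σ) = tshift (t.subst σ) := by
  simp only [tshift_eq_subst, term_subst_subst, Term.subst, liftSub]

theorem liftSub_var_comp (ρ : ℕ → ℕ) :
    liftSub (fun i => (Term.var (ρ i) : L.Term ℕ)) = fun i => Term.var (liftRen ρ i) := by
  funext i
  cases i <;> rfl

theorem liftSub_var : liftSub (Term.var : ℕ → L.Term ℕ) = Term.var := by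
  funext i
  cases i <;> rfl

theorem liftSub_comp (σ τ : ℕ → L.Term ℕ) :
    (fun i => (liftSub σ i).subst (liftSub τ)) = liftSub fun i => (σ i).subst τ := by
  funext i
  cases i with
  | zero => rfl
  | succ i => exact tshift_subst_liftSub τ (σ i)

/-- Two substitutions that differ in one variable are instances of a common one. -/
theorem exists_subst_single_eq {σ π : ℕ → L.Term ℕ} (n : ℕ) (hne : ∀ i ≠ n, σ i = π i) :
    ∃ κ : ℕ → L.Term ℕ, (∀ i, (κ i).subst (single (σ n)) = σ i) ∧
      ∀ i, (κ i).subst (single (π n)) = π i := by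
  refine ⟨fun i => if i = n then .var 0 else tshift (σ i), fun i => ?_, fun i => ?_⟩
  · by_cases hi : i = n
    · simp only [hi, if_true]; rfl
    · simp only [hi, if_false, tshift_subst_single]
  · by_cases hi : i = n
    · simp only [hi, if_true]; rfl
    · simp only [hi, if_false, tshift_subst_single, hne i hi]

theorem liftSub_eq_of_ne {σ π : ℕ → L.Term ℕ} {n : ℕ} (h : ∀ i ≠ n, σ i = π i) :
    ∀ i ≠ n + 1, liftSub σ i = liftSub π i := by
  intro i hi
  cases i with
  | zero => rfl
  | succ i => exact congrArg tshift (h i fun hn => hi (congrArg _ hn))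

end TermLemmas

namespace IForm

variable {L : FirstOrder.Language.{u, v}}

theorem rename_eq_subst (A : IForm L) (ρ : ℕ → ℕ) :
    A.rename ρ = A.subst fun i => Term.var (ρ i) := by
  induction A generalizing ρ <;>
    simp_all only [rename, subst, term_relabel_eq_subst, liftSub_var_comp]

theorem subst_subst (A : IForm L) (σ τ : ℕ → L.Term ℕ) :
    (A.subst σ).subst τ = A.subst fun i => (σ i).subst τ := by
  induction A generalizing σ τ <;>
    simp_all only [subst, term_subst_subst, liftSub_comp]

theorem subst_var (A : IForm L) : A.subst Term.var = A := by
  induction A <;> simp_all only [subst, term_subst_var, liftSub_var]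

theorem shift_eq_subst (A : IForm L) : A.shift = A.subst fun i => Term.var (i + 1) :=
  rename_eq_subst A _

theorem rename_liftRen_succ_inst_zero (A : IForm L) :
    (A.rename (liftRen Nat.succ)).inst (.var 0) = A := by
  rw [rename_eq_subst, inst, subst_subst]
  convert subst_var A using 2
  funext i
  cases i <;> rfl

theorem rename_liftRen_succ_subst_single (A : IForm L) (t : L.Term ℕ) :
    (A.rename (liftRen Nat.succ)).subst (liftSub (single t)) = A := by
  rw [rename_eq_subst, subst_subst]
  convert subst_var A using 2
  funext i
  cases i <;> rfl

theorem shift_rename_liftRen (A : IForm L) (ρ : ℕ → ℕ) :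
    A.shift.rename (liftRen ρ) = (A.rename ρ).shift := by
  simp only [shift_eq_subst, rename_eq_subst, subst_subst]
  rfl

theorem rename_rename (A : IForm L) (ρ π : ℕ → ℕ) :
    (A.rename ρ).rename π = A.rename fun i => π (ρ i) := by
  simp only [rename_eq_subst, subst_subst]
  rfl

theorem inst_rename (A : IForm L) (t : L.Term ℕ) (ρ : ℕ → ℕ) :
    (A.inst t).rename ρ = (A.rename (liftRen ρ)).inst (t.relabel ρ) := by
  simp only [inst, rename_eq_subst, subst_subst]
  congr 1
  funext i
  cases i with
  | zero => exact (term_relabel_eq_subst ρ t).symm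
  | succ i => rfl

theorem IsAtomic.rename {A : IForm L} (h : A.IsAtomic) (ρ : ℕ → ℕ) : (A.rename ρ).IsAtomic := by
  cases A <;> exact h

theorem IsAtomic.subst {A : IForm L} (h : A.IsAtomic) (σ : ℕ → L.Term ℕ) :
    (A.subst σ).IsAtomic := by
  cases A <;> exact h

end IForm

namespace IProv

open IForm

variable {L : FirstOrder.Language.{u, v}} {Γ Δ : Set (IForm L)} {A B C F G : IForm L}
  {s t r : L.Term ℕ}

theorem rename (h : IProv Γ A) {ρ : ℕ → ℕ} (hΔ : ∀ B ∈ Γ, B.rename ρ ∈ Δ) :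
    IProv Δ (A.rename ρ) := by
  have hins : ∀ {Γ Δ : Set (IForm L)} {ρ : ℕ → ℕ} (A : IForm L), (∀ B ∈ Γ, B.rename ρ ∈ Δ) →
      ∀ B ∈ insert A Γ, B.rename ρ ∈ insert (A.rename ρ) Δ := by
    rintro Γ Δ ρ A h B (rfl | hB)
    · exact Set.mem_insert _ _
    · exact Set.mem_insert_of_mem _ (h B hB)
  have hsh : ∀ {Γ Δ : Set (IForm L)} {ρ : ℕ → ℕ}, (∀ B ∈ Γ, B.rename ρ ∈ Δ) →
      ∀ B ∈ shift '' Γ, B.rename (liftRen ρ) ∈ shift '' Δ := by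
    rintro Γ Δ ρ h _ ⟨B, hB, rfl⟩
    exact ⟨_, h B hB, (shift_rename_liftRen B ρ).symm⟩
  induction h generalizing ρ Δ with
  | ax h => exact ax (hΔ _ h)
  | andI _ _ ih1 ih2 => exact andI (ih1 hΔ) (ih2 hΔ)
  | andE1 _ ih => exact andE1 (ih hΔ)
  | andE2 _ ih => exact andE2 (ih hΔ)
  | impI _ ih => exact impI (ih (hins _ hΔ))
  | impE _ _ ih1 ih2 => exact impE (ih1 hΔ) (ih2 hΔ)
  | orI1 _ ih => exact orI1 (ih hΔ)
  | orI2 _ ih => exact orI2 (ih hΔ)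
  | orE _ _ _ ih ih1 ih2 => exact orE (ih hΔ) (ih1 (hins _ hΔ)) (ih2 (hins _ hΔ))
  | falsumE ha _ ih => exact falsumE (ha.rename ρ) (ih hΔ)
  | allI _ ih => exact allI (ih (hins _ (hsh hΔ)))
  | allE t _ _ ih1 ih2 =>
    rw [inst_rename]
    exact allE _ (ih1 hΔ) (ih2 hΔ)
  | exI t _ _ ih1 ih2 =>
    have := ih1 hΔ
    rw [inst_rename] at this
    exact exI _ this (ih2 hΔ)
  | exE _ _ ih1 ih2 =>
    refine exE (ih1 hΔ) ?_
    rw [← shift_rename_liftRen]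
    exact ih2 (hins _ (hins _ (hsh hΔ)))
  | eqI _ ih => exact eqI (ih hΔ)
  | eqE ha _ _ ih1 ih2 =>
    have := ih2 hΔ
    rw [inst_rename] at this ⊢
    exact eqE (ha.rename _) (ih1 hΔ) this
  | adRel i _ ih => exact adRel i (ih hΔ)
  | adEq1 _ ih => exact adEq1 (ih hΔ)
  | adEq2 _ ih => exact adEq2 (ih hΔ)
  | iotaI t _ _ _ _ ih1 ih2 ih3 ih4 =>
    have h1 := ih1 hΔ
    have h2 := ih2 hΔ
    rw [inst_rename] at h1 h2
    have h4 := ih4 (hins _ (hins _ (hsh hΔ)))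
    simp only [IForm.rename, tshift_relabel_liftRen] at h4
    exact iotaI _ h1 h2 (ih3 hΔ) h4
  | iotaE1 _ _ ih1 ih2 =>
    refine iotaE1 (ih1 hΔ) ?_
    rw [← shift_rename_liftRen]
    exact ih2 (hins _ (hins _ (hins _ (hsh hΔ))))
  | iotaE2 _ _ _ _ _ ih1 ih2 ih3 ih4 ih5 =>
    have h4 := ih4 hΔ
    have h5 := ih5 hΔ
    rw [inst_rename] at h4 h5
    exact iotaE2 (ih1 hΔ) (ih2 hΔ) (ih3 hΔ) h4 h5

theorem weaken (h : IProv Γ A) (hΔ : Γ ⊆ Δ) : IProv Δ A := by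
  have hid : ∀ A : IForm L, A.rename id = A := fun A => by
    rw [rename_eq_subst]
    exact subst_var A
  have := h.rename (ρ := id) (Δ := Δ) fun B hB => by
    rw [hid]
    exact hΔ hB
  rwa [hid] at this

theorem up (h : IProv Γ A) (hΔ : shift '' Γ ⊆ Δ) : IProv Δ A.shift :=
  h.rename fun B hB => hΔ ⟨B, hB, rfl⟩

theorem eq_symm (h : IProv Γ (eq s t)) : IProv Γ (eq t s) := by
  have := eqE (A := eq (.var 0) (tshift s)) (s := s) (t := t) trivial h (by
    simpa only [inst, subst, Term.subst, single, tshift_subst_single] using eqI (adEq1 h))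
  simpa only [inst, subst, Term.subst, single, tshift_subst_single] using this

theorem eq_trans (h : IProv Γ (eq s t)) (h' : IProv Γ (eq t r)) : IProv Γ (eq s r) := by
  have := eqE (A := eq (tshift s) (.var 0)) (s := t) (t := r) trivial h' (by
    simpa only [inst, subst, Term.subst, single, tshift_subst_single] using h)
  simpa only [inst, subst, Term.subst, single, tshift_subst_single] using this

theorem iff_refl (A : IForm L) : IProv Γ (IForm.iff A A) :=
  andI (impI (ax (Set.mem_insert _ _))) (impI (ax (Set.mem_insert _ _)))

theorem iff_symm (h : IProv Γ (IForm.iff A B)) : IProv Γ (IForm.iff B A) :=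
  andI (andE2 h) (andE1 h)

theorem iff_mp (h : IProv Γ (IForm.iff A B)) (h' : IProv Γ A) : IProv Γ B :=
  impE (andE1 h) h'

theorem iff_mpr (h : IProv Γ (IForm.iff A B)) (h' : IProv Γ B) : IProv Γ A :=
  impE (andE2 h) h'

theorem falsum_elim (h : IProv Γ falsum) (A : IForm L) : IProv Γ A := by
  suffices H : ∀ σ, IProv Γ (A.subst σ) by simpa only [subst_var] using H Term.var
  induction A generalizing Γ with
  | falsum => exact fun _ => h
  | rel R ts => exact fun _ => falsumE trivial h
  | exi t => exact fun _ => falsumE trivial h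
  | eq s t => exact fun _ => falsumE trivial h
  | and A B ihA ihB => exact fun σ => andI (ihA h σ) (ihB h σ)
  | or A B ihA ihB => exact fun σ => orI1 (ihA h σ)
  | imp A B ihA ihB => exact fun σ => impI (ihB (h.weaken (Set.subset_insert _ _)) σ)
  | all A ih => exact fun σ => allI (ih (h.up (Set.subset_insert _ _)) _)
  | ex A ih =>
    refine fun σ => exI (.var 0) ?_ (falsumE trivial h)
    rw [inst, subst_subst]
    exact ih h _
  | iota F G ihF ihG =>
    refine fun σ => iotaI (.var 0) ?_ ?_ (falsumE trivial h)
      (falsumE trivial (h.up fun _ h => .inr (.inr h)))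
    · rw [inst, subst_subst]
      exact ihF h _
    · rw [inst, subst_subst]
      exact ihG h _

theorem all_up (h : IProv Γ (all A)) (hΔ : shift '' Γ ⊆ Δ) (h0 : IProv Δ (exi (.var 0))) :
    IProv Δ A := by
  have := allE (.var 0) (h.up hΔ) h0
  rwa [rename_liftRen_succ_inst_zero] at this

theorem ex_shift_intro (h : IProv Δ A) (h0 : IProv Δ (exi (.var 0))) : IProv Δ (ex A).shift := by
  refine exI (.var 0) ?_ h0
  rwa [rename_liftRen_succ_inst_zero]

theorem all_mono (h : IProv Γ (all A))
    (hAB : IProv (insert A (insert (exi (.var 0)) (shift '' Γ))) B) : IProv Γ (all B) := by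
  refine allI (impE (impI hAB) (h.all_up (Set.subset_insert _ _) (ax (.inl rfl))))

theorem ex_mono (h : IProv Γ (ex A))
    (hAB : IProv (insert A (insert (exi (.var 0)) (shift '' Γ))) B) : IProv Γ (ex B) :=
  exE h (ex_shift_intro hAB (ax (.inr (.inl rfl))))

/-- Moving a deduction under one binder past a second binder that is put outside of it. -/
theorem lift (h : IProv (insert A (insert (exi (.var 0)) (shift '' Γ))) B)
    (hΔ : shift '' Γ ⊆ Δ) :
    IProv (insert (A.rename (liftRen Nat.succ)) (insert (exi (.var 0)) (shift '' Δ)))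
      (B.rename (liftRen Nat.succ)) := by
  refine h.rename ?_
  rintro C (rfl | rfl | ⟨C, hC, rfl⟩)
  · exact .inl rfl
  · exact .inr (.inl rfl)
  · rw [shift_rename_liftRen]
    exact .inr (.inr ⟨_, hΔ ⟨C, hC, rfl⟩, rfl⟩)

theorem iota_uniq (h : IProv Γ (iota F G)) (hΔ : shift '' Γ ⊆ Δ)
    (h0 : IProv Δ (exi (.var 0))) (hF : IProv Δ F) (ht : IProv Δ (exi t))
    (hFt : IProv Δ ((F.rename (liftRen Nat.succ)).inst t)) : IProv Δ (eq (.var 0) t) := by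
  refine iotaE2 (h.up hΔ) h0 ht ?_ hFt
  rwa [rename_liftRen_succ_inst_zero]

theorem iota_mono {F' G' : IForm L} (h : IProv Γ (iota F G))
    (hF : IProv (insert F (insert (exi (.var 0)) (shift '' Γ))) F')
    (hF' : IProv (insert F' (insert (exi (.var 0)) (shift '' Γ))) F)
    (hG : IProv (insert G (insert (exi (.var 0)) (shift '' Γ))) G') :
    IProv Γ (iota F' G') := by
  refine iotaE1 h (iotaI (.var 0) ?_ ?_ (ax (.inr (.inr (.inl rfl)))) ?_)
  · rw [rename_liftRen_succ_inst_zero]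
    exact hF.weaken (Set.insert_subset_insert (Set.subset_insert _ _))
  · rw [rename_liftRen_succ_inst_zero]
    exact hG.weaken (Set.subset_insert _ _)
  · refine iota_uniq (h.up (Δ := insert F (insert G (insert (exi (.var 0)) (shift '' Γ))))
      fun _ h => .inr (.inr (.inr h))) (fun _ h => .inr (.inr h)) (ax (.inr (.inl rfl))) ?_ ?_ ?_
    · exact hF'.lift fun _ h => .inr (.inr (.inr h))
    · exact ax (.inr (.inr ⟨_, .inr (.inr (.inl rfl)), rfl⟩))
    · have : ((F.rename (liftRen Nat.succ)).rename (liftRen Nat.succ)).inst (tshift (.var 0)) =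
          F.shift := by
        rw [tshift, ← inst_rename, rename_liftRen_succ_inst_zero, shift]
      rw [this]
      exact ax (.inr (.inr ⟨F, .inl rfl, rfl⟩))

theorem atomic_subst_of_eq (hA : A.IsAtomic) {σ π : ℕ → L.Term ℕ} (n : ℕ)
    (hne : ∀ i ≠ n, σ i = π i) (he : IProv Γ (eq (σ n) (π n))) (h : IProv Γ (A.subst σ)) :
    IProv Γ (A.subst π) := by
  obtain ⟨κ, hσ, hπ⟩ := exists_subst_single_eq n hne
  have hσ : (A.subst κ).inst (σ n) = A.subst σ := by
    rw [inst, subst_subst]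
    exact congrArg (IForm.subst · A) (funext hσ)
  have hπ : (A.subst κ).inst (π n) = A.subst π := by
    rw [inst, subst_subst]
    exact congrArg (IForm.subst · A) (funext hπ)
  rw [← hπ]
  exact eqE (hA.subst _) he (by rwa [hσ])

/-- Leibniz' Law, for two substitutions that differ in one variable. -/
theorem subst_of_eq (A : IForm L) {σ π : ℕ → L.Term ℕ} (n : ℕ) (hne : ∀ i ≠ n, σ i = π i)
    (he : IProv Γ (eq (σ n) (π n))) (h : IProv Γ (A.subst σ)) : IProv Γ (A.subst π) := by
  induction A generalizing Γ σ π n with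
  | falsum => exact h
  | rel R ts => exact atomic_subst_of_eq (A := rel R ts) trivial n hne he h
  | exi t => exact atomic_subst_of_eq (A := exi t) trivial n hne he h
  | eq s t => exact atomic_subst_of_eq (A := eq s t) trivial n hne he h
  | and A B ihA ihB => exact andI (ihA n hne he (andE1 h)) (ihB n hne he (andE2 h))
  | or A B ihA ihB =>
    exact orE h
      (orI1 (ihA n hne (he.weaken (Set.subset_insert _ _)) (ax (.inl rfl))))
      (orI2 (ihB n hne (he.weaken (Set.subset_insert _ _)) (ax (.inl rfl))))
  | imp A B ihA ihB =>
    have he' := he.weaken (Set.subset_insert (A.subst π) _)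
    exact impI (ihB n hne he' (impE (h.weaken (Set.subset_insert _ _))
      (ihA n (fun i hi => (hne i hi).symm) he'.eq_symm (ax (.inl rfl)))))
  | all A ih =>
    exact h.all_mono (ih (n + 1) (liftSub_eq_of_ne hne) (he.up fun _ h => .inr (.inr h))
      (ax (.inl rfl)))
  | ex A ih =>
    exact h.ex_mono (ih (n + 1) (liftSub_eq_of_ne hne) (he.up fun _ h => .inr (.inr h))
      (ax (.inl rfl)))
  | iota F G ihF ihG =>
    refine h.iota_mono ?_ ?_ ?_
    · exact ihF (n + 1) (liftSub_eq_of_ne hne) (he.up fun _ h => .inr (.inr h)) (ax (.inl rfl))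
    · exact ihF (n + 1) (fun i hi => (liftSub_eq_of_ne hne i hi).symm)
        (he.eq_symm.up fun _ h => .inr (.inr h)) (ax (.inl rfl))
    · exact ihG (n + 1) (liftSub_eq_of_ne hne) (he.up fun _ h => .inr (.inr h)) (ax (.inl rfl))

theorem inst_of_eq (h : IProv Γ (eq s t)) (hA : IProv Γ (A.inst s)) : IProv Γ (A.inst t) :=
  subst_of_eq A (σ := single s) (π := single t) 0
    (fun i hi => by cases i with
      | zero => exact (hi rfl).elim
      | succ i => rfl) h hA

theorem iota_change {G' : IForm L} (h : IProv Γ (iota F G)) (hF : IProv Γ (F.inst t))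
    (ht : IProv Γ (exi t)) (hG : IProv Γ (G'.inst t)) : IProv Γ (iota F G') := by
  refine iotaI t hF hG ht (iota_uniq h (fun _ h => .inr (.inr h)) (ax (.inr (.inl rfl)))
    (ax (.inl rfl)) (ht.up fun _ h => .inr (.inr h)) ?_)
  rw [tshift, ← inst_rename]
  exact hF.up fun _ h => .inr (.inr h)

/-- The formula `ι x [F, x = t]`, "the `F` is `t`". -/
theorem iota_eq_elim (h : IProv Γ (iota F (eq (.var 0) (tshift t)))) :
    IProv Γ (F.inst t) ∧ IProv Γ (exi t) := by
  constructor
  · refine iotaE1 h ?_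
    have : IProv (insert F (insert (eq (.var 0) (tshift t)) (insert (exi (.var 0)) (shift '' Γ))))
        ((F.rename (liftRen Nat.succ)).inst (tshift t)) :=
      inst_of_eq (s := .var 0) (ax (.inr (.inl rfl))) (by
        rw [rename_liftRen_succ_inst_zero]
        exact ax (.inl rfl))
    rwa [tshift, ← inst_rename] at this
  · exact iotaE1 h (adEq2 (s := .var 0) (ax (.inr (.inl rfl))))

theorem iota_eq_intro (h : IProv Γ (iota F G)) (hF : IProv Γ (F.inst t)) (ht : IProv Γ (exi t)) :
    IProv Γ (iota F (eq (.var 0) (tshift t))) :=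
  h.iota_change hF ht (by
    simpa only [inst, subst, Term.subst, single, tshift_subst_single] using eqI ht)

theorem iota_of_iota_eq (h : IProv Γ (iota F (eq (.var 0) (tshift t))))
    (hG : IProv Γ (G.inst t)) : IProv Γ (iota F G) :=
  h.iota_change h.iota_eq_elim.1 h.iota_eq_elim.2 hG

theorem cut (h : IProv Γ A) (h' : IProv (insert A Γ) B) : IProv Γ B :=
  impE (impI h') h

theorem ex_of_iota (h : IProv Γ (iota F G)) :
    IProv Γ (ex (and (iota (F.rename (liftRen Nat.succ)) (eq (.var 0) (.var 1))) G)) := by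
  refine iotaE1 h (ex_shift_intro (andI ?_ (ax (.inr (.inl rfl)))) (ax (.inr (.inr (.inl rfl)))))
  refine iota_eq_intro (t := .var 0) (h.up fun _ h => .inr (.inr (.inr h))) ?_
    (ax (.inr (.inr (.inl rfl))))
  rw [rename_liftRen_succ_inst_zero]
  exact ax (.inl rfl)

end IProv

section TauSyntax

open IForm

variable {L : FirstOrder.Language.{u, v}}

theorem DTerm.ord_subst_ord (σ : ℕ → L.Term ℕ) (t : L.Term ℕ) :
    (DTerm.ord t).subst (fun i => .ord (σ i)) = .ord (t.subst σ) := by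
  cases t <;> simp only [DTerm.subst, Term.subst, DTerm.toTerm]

theorem DTerm.iota_subst (σ : ℕ → DTerm L) (A : DForm L) :
    (DTerm.iota A).subst σ = .iota (A.subst (liftDSub σ)) := by
  simp only [DTerm.subst]

theorem liftDSub_ord (σ : ℕ → L.Term ℕ) :
    liftDSub (fun i => .ord (σ i)) = fun i => .ord (liftSub σ i) := by
  funext i
  cases i with
  | zero => rfl
  | succ i => simp only [liftDSub, DTerm.shift, DTerm.rename, liftSub, tshift]

theorem dsingle_ord (t : L.Term ℕ) : dsingle (.ord t) = fun i => .ord (single t i) := by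
  funext i
  cases i <;> rfl

theorem rename_liftRen_succ_comm (A : IForm L) (ρ : ℕ → ℕ) :
    (A.rename (liftRen ρ)).rename (liftRen Nat.succ) =
      (A.rename (liftRen Nat.succ)).rename (liftRen (liftRen ρ)) := by
  simp only [IForm.rename_rename]
  congr 1
  funext i
  cases i <;> rfl

theorem subst_liftSub_rename_liftRen_succ (A : IForm L) (σ : ℕ → L.Term ℕ) :
    (A.subst (liftSub σ)).rename (liftRen Nat.succ) =
      (A.rename (liftRen Nat.succ)).subst (liftSub (liftSub σ)) := by
  simp only [rename_eq_subst, subst_subst]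
  congr 1
  funext i
  cases i with
  | zero => rfl
  | succ i =>
    simp only [liftSub, tshift_eq_subst, term_subst_subst, liftRen, Term.subst]

theorem tau_rename : (A : DForm L) → (ρ : ℕ → ℕ) → tau (A.rename ρ) = (tau A).rename ρ
  | .falsum, _ => rfl
  | .rel _ _, _ => rfl
  | .exi (.ord _), _ => rfl
  | .exi (.iota A), ρ => by
    simp only [DForm.rename, DTerm.rename, tau, IForm.rename, tau_rename A]; rfl
  | .eq (.ord _) (.ord _), _ => rfl
  | .eq (.iota A) (.ord t), ρ => by
    simp only [DForm.rename, DTerm.rename, tau, IForm.rename, tau_rename A,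
      tshift_relabel_liftRen]; rfl
  | .eq (.ord _) (.iota B), ρ => by
    simp only [DForm.rename, DTerm.rename, tau, IForm.rename, tau_rename B,
      tshift_relabel_liftRen]; rfl
  | .eq (.iota A) (.iota B), ρ => by
    simp only [DForm.rename, DTerm.rename, tau, IForm.rename, tau_rename A, tau_rename B,
      rename_liftRen_succ_comm]; rfl
  | .and A B, ρ => by simp only [DForm.rename, tau, IForm.rename, tau_rename A, tau_rename B]
  | .or A B, ρ => by simp only [DForm.rename, tau, IForm.rename, tau_rename A, tau_rename B]
  | .imp A B, ρ => by simp only [DForm.rename, tau, IForm.rename, tau_rename A, tau_rename B]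
  | .all A, ρ => by simp only [DForm.rename, tau, IForm.rename, tau_rename A]
  | .ex A, ρ => by simp only [DForm.rename, tau, IForm.rename, tau_rename A]
  | .delta B (.ord t), ρ => by
    simp only [DForm.rename, DTerm.rename, tau, IForm.rename, tau_rename B,
      tshift_relabel_liftRen]; rfl
  | .delta B (.iota A), ρ => by
    simp only [DForm.rename, DTerm.rename, tau, IForm.rename, tau_rename A, tau_rename B]

theorem tau_subst_ord : (A : DForm L) → (σ : ℕ → L.Term ℕ) →
    tau (A.subst fun i => .ord (σ i)) = (tau A).subst σ
  | .falsum, _ => rfl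
  | .rel _ _, _ => rfl
  | .exi (.ord _), _ => by simp only [DForm.subst, DTerm.ord_subst_ord, tau, IForm.subst]
  | .exi (.iota A), σ => by
    simp only [DForm.subst, DTerm.iota_subst, liftDSub_ord, tau, IForm.subst, tau_subst_ord A]; rfl
  | .eq (.ord _) (.ord _), _ => by simp only [DForm.subst, DTerm.ord_subst_ord, tau, IForm.subst]
  | .eq (.iota A) (.ord t), σ => by
    simp only [DForm.subst, DTerm.iota_subst, DTerm.ord_subst_ord, liftDSub_ord, tau, IForm.subst,
      tau_subst_ord A, tshift_subst_liftSub]; rfl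
  | .eq (.ord _) (.iota B), σ => by
    simp only [DForm.subst, DTerm.iota_subst, DTerm.ord_subst_ord, liftDSub_ord, tau, IForm.subst,
      tau_subst_ord B, tshift_subst_liftSub]; rfl
  | .eq (.iota A) (.iota B), σ => by
    simp only [DForm.subst, DTerm.iota_subst, liftDSub_ord, tau, IForm.subst,
      tau_subst_ord A, tau_subst_ord B, subst_liftSub_rename_liftRen_succ]; rfl
  | .and A B, σ => by simp only [DForm.subst, tau, IForm.subst, tau_subst_ord A, tau_subst_ord B]
  | .or A B, σ => by simp only [DForm.subst, tau, IForm.subst, tau_subst_ord A, tau_subst_ord B]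
  | .imp A B, σ => by simp only [DForm.subst, tau, IForm.subst, tau_subst_ord A, tau_subst_ord B]
  | .all A, σ => by simp only [DForm.subst, liftDSub_ord, tau, IForm.subst, tau_subst_ord A]
  | .ex A, σ => by simp only [DForm.subst, liftDSub_ord, tau, IForm.subst, tau_subst_ord A]
  | .delta B (.ord t), σ => by
    simp only [DForm.subst, DTerm.ord_subst_ord, liftDSub_ord, tau, IForm.subst,
      tau_subst_ord B, tshift_subst_liftSub]; rfl
  | .delta B (.iota A), σ => by
    simp only [DForm.subst, DTerm.iota_subst, liftDSub_ord, tau, IForm.subst, tau_subst_ord A,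
      tau_subst_ord B]

theorem tau_shift (A : DForm L) : tau A.shift = (tau A).shift := tau_rename A _

theorem tau_inst_ord (A : DForm L) (t : L.Term ℕ) : tau (A.inst (.ord t)) = (tau A).inst t := by
  rw [DForm.inst, dsingle_ord, tau_subst_ord, IForm.inst]

/-- The translation of `t = u`, which says that `t` denotes the value of the ordinary term `u`. -/
def denotes (t : DTerm L) (u : L.Term ℕ) : IForm L := tau (.eq t (.ord u))

/-- The translation of `t = x`, where `x` is a new variable. -/
def graph (t : DTerm L) : IForm L := denotes t.shift (.var 0)

theorem denotes_rename (t : DTerm L) (u : L.Term ℕ) (ρ : ℕ → ℕ) :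
    (denotes t u).rename ρ = denotes (t.rename ρ) (u.relabel ρ) :=
  (tau_rename (.eq t (.ord u)) ρ).symm

theorem denotes_shift (t : DTerm L) (u : L.Term ℕ) :
    (denotes t u).shift = denotes t.shift (tshift u) := denotes_rename t u _

theorem graph_inst (t : DTerm L) (u : L.Term ℕ) : (graph t).inst u = denotes t u := by
  cases t with
  | ord t =>
    simp only [graph, denotes, DTerm.shift, DTerm.rename, tau, inst, subst, Term.subst, single]
    congr 1
    exact tshift_subst_single u t
  | iota A =>
    simp only [graph, denotes, DTerm.shift, DTerm.rename, tau, inst, subst, tau_rename,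
      rename_liftRen_succ_subst_single, tshift_subst_liftSub]
    rfl

theorem graph_rename (t : DTerm L) (ρ : ℕ → ℕ) :
    (graph t).rename (liftRen ρ) = graph (t.rename ρ) := by
  cases t with
  | ord t =>
    simp only [graph, denotes, DTerm.shift, DTerm.rename, tau, IForm.rename]
    congr 1
    exact tshift_relabel_liftRen ρ t
  | iota A =>
    simp only [graph, denotes, DTerm.shift, DTerm.rename, tau, IForm.rename, tau_rename,
      rename_liftRen_succ_comm]
    rfl

theorem denotes_ord (s t : L.Term ℕ) : denotes (.ord s) t = eq s t := rfl

theorem graph_iota (A : DForm L) :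
    graph (.iota A) = iota ((tau A).rename (liftRen Nat.succ)) (eq (.var 0) (.var 1)) := by
  rw [← tau_rename]; rfl

end TauSyntax

namespace IProv

open IForm

variable {L : FirstOrder.Language.{u, v}} {Γ Δ : Set (IForm L)} {A B C F G : IForm L}
  {r s t : DTerm L} {u w : L.Term ℕ}

theorem exi_of_denotes (h : IProv Γ (denotes t u)) : IProv Γ (exi u) := by
  cases t with
  | ord t => exact adEq2 h
  | iota A => exact h.iota_eq_elim.2

theorem denotes_uniq (h : IProv Γ (denotes t u)) (h' : IProv Γ (denotes t w)) :
    IProv Γ (eq u w) := by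
  cases t with
  | ord t => exact h.eq_symm.eq_trans h'
  | iota A =>
    exact iotaE2 h h.iota_eq_elim.2 h'.iota_eq_elim.2 h.iota_eq_elim.1 h'.iota_eq_elim.1

theorem denotes_of_eq (h : IProv Γ (denotes t u)) (he : IProv Γ (eq u w)) :
    IProv Γ (denotes t w) := by
  rw [← graph_inst] at h ⊢
  exact inst_of_eq he h

theorem iota_eq_comm (h : IProv Γ (iota F (eq u w))) : IProv Γ (iota F (eq w u)) :=
  h.iota_mono (ax (.inl rfl)) (ax (.inl rfl)) (eq_symm (ax (.inl rfl)))

theorem tau_exi_intro (h : IProv Γ (denotes t u)) : IProv Γ (tau (.exi t)) := by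
  cases t with
  | ord t => exact adEq1 h
  | iota A => exact h.iota_of_iota_eq h.exi_of_denotes

theorem tau_exi_elim (h : IProv Γ (tau (.exi t))) : IProv Γ (ex (graph t)) := by
  cases t with
  | ord t => exact exI t (by rw [graph_inst]; exact eqI h) h
  | iota A =>
    rw [graph_iota]
    exact (ex_of_iota h).ex_mono (andE1 (ax (.inl rfl)))

theorem tau_eq_intro (hs : IProv Γ (denotes s u)) (ht : IProv Γ (denotes t u)) :
    IProv Γ (tau (.eq s t)) := by
  cases s with
  | ord s =>
    cases t with
    | ord t => exact hs.eq_trans ht.eq_symm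
    | iota B =>
      refine hs.cut ?_
      refine (ht.weaken (Set.subset_insert _ _)).iota_of_iota_eq ?_
      simpa only [inst, subst, Term.subst, single, tshift_subst_single] using ax (.inl rfl)
  | iota A =>
    cases t with
    | ord t =>
      refine hs.iota_of_iota_eq ?_
      simpa only [inst, subst, Term.subst, single, tshift_subst_single] using ht.eq_symm
    | iota B =>
      refine hs.iota_of_iota_eq ?_
      simp only [inst, subst, rename_liftRen_succ_subst_single]
      exact ht.iota_eq_comm

theorem tau_eq_elim (h : IProv Γ (tau (.eq s t))) :
    IProv Γ (ex (and (graph s) (graph t))) := by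
  have key : ∀ {u}, IProv Γ (denotes s u) → IProv Γ (denotes t u) →
      IProv Γ (ex (and (graph s) (graph t))) := fun {u} hs ht => by
    refine exI u ?_ hs.exi_of_denotes
    rw [← graph_inst] at hs ht
    exact andI hs ht
  cases s with
  | ord s =>
    cases t with
    | ord t => exact key h (eqI (adEq2 h))
    | iota B => exact key (eqI (h.iota_eq_comm.iota_eq_elim.2)) h.iota_eq_comm
  | iota A =>
    cases t with
    | ord t => exact key h (eqI h.iota_eq_elim.2)
    | iota B =>
      simp only [graph_iota]
      exact (ex_of_iota h).ex_mono (andI (andE1 (ax (.inl rfl)))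
        (iota_eq_comm (andE2 (ax (.inl rfl)))))

theorem tau_delta_intro {B : DForm L} (h : IProv Γ (denotes t u)) (hB : IProv Γ ((tau B).inst u)) :
    IProv Γ (tau (.delta B t)) := by
  cases t with
  | ord t =>
    refine iotaI u ?_ hB h.exi_of_denotes ?_
    · simpa only [inst, subst, Term.subst, single, tshift_subst_single, denotes_ord] using h
    · exact (eq_symm (ax (.inl rfl))).eq_trans (h.up fun _ h => .inr (.inr h))
  | iota A => exact h.iota_of_iota_eq hB

theorem tau_delta_elim {B : DForm L} (h : IProv Γ (tau (.delta B t))) :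
    IProv Γ (ex (and (graph t) (tau B))) := by
  cases t with
  | ord t =>
    exact iotaE1 h (ex_shift_intro (andI (ax (.inl rfl)) (ax (.inr (.inl rfl))))
      (ax (.inr (.inr (.inl rfl)))))
  | iota A =>
    rw [graph_iota]
    exact ex_of_iota h

end IProv

section Codenotation

open IForm

variable {L : FirstOrder.Language.{u, v}} {Γ Δ : Set (IForm L)} {r s t : DTerm L} {u : L.Term ℕ}
  {A B : DForm L}

/-- It is provable that `s` and `t` denote the same, if they denote anything. -/
def Codenotes (Γ : Set (IForm L)) (s t : DTerm L) : Prop :=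
  IProv Γ (all (IForm.iff (graph s) (graph t)))

namespace Codenotes

theorem refl (Γ : Set (IForm L)) (t : DTerm L) : Codenotes Γ t t :=
  IProv.allI (IProv.iff_refl _)

theorem symm (h : Codenotes Γ s t) : Codenotes Γ t s :=
  h.all_mono (IProv.ax (.inl rfl)).iff_symm

theorem weaken (h : Codenotes Γ s t) (hΔ : Γ ⊆ Δ) : Codenotes Δ s t :=
  IProv.weaken h hΔ

theorem up (h : Codenotes Γ s t) (hΔ : shift '' Γ ⊆ Δ) : Codenotes Δ s.shift t.shift := by
  have := IProv.up h hΔ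
  simp only [shift, IForm.rename, IForm.iff, graph_rename] at this
  exact this

theorem graph (h : Codenotes Γ s t) (hΔ : shift '' Γ ⊆ Δ) (hs : IProv Δ (graph s)) :
    IProv Δ (graph t) :=
  (h.all_up hΔ hs.exi_of_denotes).iff_mp hs

theorem of_denotes (hs : IProv Γ (denotes s u)) (ht : IProv Γ (denotes t u)) :
    Codenotes Γ s t := by
  have key : ∀ {s t : DTerm L}, IProv Γ (denotes s u) → IProv Γ (denotes t u) →
      IProv (insert (exi (.var 0)) (shift '' Γ)) (imp (FreeLogic.graph s) (FreeLogic.graph t)) := by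
    intro s t hs ht
    refine IProv.impI ?_
    have hs' := hs.up (Δ := insert (FreeLogic.graph s) (insert (exi (.var 0)) (shift '' Γ)))
      fun _ h => .inr (.inr h)
    have ht' := ht.up (Δ := insert (FreeLogic.graph s) (insert (exi (.var 0)) (shift '' Γ)))
      fun _ h => .inr (.inr h)
    rw [denotes_shift] at hs' ht'
    exact ht'.denotes_of_eq (hs'.denotes_uniq (IProv.ax (.inl rfl)))
  exact IProv.allI (IProv.andI (key hs ht) (key ht hs))

theorem iota (hA : IProv (insert (tau A) (insert (exi (.var 0)) (shift '' Γ))) (tau B))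
    (hB : IProv (insert (tau B) (insert (exi (.var 0)) (shift '' Γ))) (tau A)) :
    Codenotes Γ (.iota A) (.iota B) := by
  have key : ∀ {A B : DForm L},
      IProv (insert (tau A) (insert (exi (.var 0)) (shift '' Γ))) (tau B) →
      IProv (insert (tau B) (insert (exi (.var 0)) (shift '' Γ))) (tau A) →
      IProv (insert (exi (.var 0)) (shift '' Γ))
        (imp (FreeLogic.graph (.iota A)) (FreeLogic.graph (.iota B))) := by
    intro A B hA hB
    refine IProv.impI ?_
    simp only [graph_iota]
    exact IProv.iota_mono (IProv.ax (.inl rfl)) (hA.lift fun _ h => .inr (.inr h))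
      (hB.lift fun _ h => .inr (.inr h)) (IProv.ax (.inl rfl))
  exact IProv.allI (IProv.andI (key hA hB) (key hB hA))

end Codenotes

/-- `σ` and `π` are interchangeable in an expression in which `ι` terms may be put for the
variables that satisfy `P`. -/
def SubstRel (Γ : Set (IForm L)) (P : ℕ → Prop) (σ π : ℕ → DTerm L) : Prop :=
  ∀ i, σ i = π i ∨ (P i ∧ Codenotes Γ (σ i) (π i))

namespace SubstRel

variable {P Q : ℕ → Prop} {σ π : ℕ → DTerm L}

theorem symm (h : SubstRel Γ P σ π) : SubstRel Γ P π σ := fun i =>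
  (h i).imp Eq.symm fun h => ⟨h.1, h.2.symm⟩

theorem weaken (h : SubstRel Γ P σ π) (hΔ : Γ ⊆ Δ) : SubstRel Δ P σ π := fun i =>
  (h i).imp_right fun h => ⟨h.1, h.2.weaken hΔ⟩

theorem mono (h : SubstRel Γ P σ π) (hP : ∀ i, P i → Q i) : SubstRel Γ Q σ π := fun i =>
  (h i).imp_right fun h => ⟨hP i h.1, h.2⟩

theorem lift (h : SubstRel Γ P σ π) (hP : ∀ i, P i → Q (i + 1)) (hΔ : shift '' Γ ⊆ Δ) :
    SubstRel Δ Q (liftDSub σ) (liftDSub π) := fun i =>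
  match i with
  | 0 => .inl rfl
  | i + 1 => (h i).imp (congrArg DTerm.shift) fun h => ⟨hP i h.1, h.2.up hΔ⟩

theorem toTerm_subst (h : SubstRel Γ P σ π) (t : L.Term ℕ) (hP : ∀ i, P i → i ∉ t.varFinset) :
    (t.subst fun i => (σ i).toTerm) = t.subst fun i => (π i).toTerm :=
  term_subst_congr t fun i hi => (h i).elim (congrArg DTerm.toTerm) fun h => (hP i h.1 hi).elim

end SubstRel

variable {σ π : ℕ → DTerm L}

mutual

theorem Codenotes.subst : (r : DTerm L) → ∀ {Γ : Set (IForm L)} {σ π : ℕ → DTerm L},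
    SubstRel Γ (fun i => r.Iotable i) σ π → Codenotes Γ (r.subst σ) (r.subst π)
  | .ord (.var i), Γ, σ, π, h => by
    simp only [DTerm.subst]
    rcases h i with h | h
    · rw [h]
      exact .refl _ _
    · exact h.2
  | .ord (.func f ts), Γ, σ, π, h => by
    simp only [DTerm.subst]
    rw [h.toTerm_subst _ fun i hi => by simpa only [DTerm.Iotable] using hi]
    exact .refl _ _
  | .iota A, Γ, σ, π, h => by
    simp only [DTerm.subst]
    have h' := h.lift (Q := fun i => A.Iotable i)
      (Δ := insert (exi (.var 0)) (shift '' Γ))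
      (fun i hi => by simpa only [DTerm.Iotable] using hi) (Set.subset_insert _ _)
    exact .iota (IProv.tau_subst_mono A (h'.weaken (Set.subset_insert _ _)) (.ax (.inl rfl)))
      (IProv.tau_subst_mono A (h'.symm.weaken (Set.subset_insert _ _)) (.ax (.inl rfl)))

theorem IProv.tau_subst_mono : (A : DForm L) → ∀ {Γ : Set (IForm L)} {σ π : ℕ → DTerm L},
    SubstRel Γ (fun i => A.Iotable i) σ π → IProv Γ (tau (A.subst σ)) →
      IProv Γ (tau (A.subst π))
  | .falsum, Γ, σ, π, _, hA => hA
  | .rel R ts, Γ, σ, π, h, hA => by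
    have : ((DForm.rel R ts).subst σ) = (DForm.rel R ts).subst π := by
      simp only [DForm.subst]
      congr 1
      funext k
      exact h.toTerm_subst _ fun i hi => by
        simp only [DForm.Iotable] at hi
        exact hi k
    rwa [← this]
  | .exi t, Γ, σ, π, h, hA => by
    simp only [DForm.subst] at hA ⊢
    have ht := Codenotes.subst t (h.mono fun i hi => by simpa only [DForm.Iotable] using hi)
    refine hA.tau_exi_elim.exE ?_
    rw [← tau_shift]
    exact (ht.graph (fun _ h => .inr (.inr h)) (.ax (.inl rfl))).tau_exi_intro
  | .eq s t, Γ, σ, π, h, hA => by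
    simp only [DForm.subst] at hA ⊢
    have hs := Codenotes.subst s (h.mono fun i hi => by
      simp only [DForm.Iotable] at hi; exact hi.1)
    have ht := Codenotes.subst t (h.mono fun i hi => by
      simp only [DForm.Iotable] at hi; exact hi.2)
    refine hA.tau_eq_elim.exE ?_
    rw [← tau_shift]
    exact (hs.graph (fun _ h => .inr (.inr h)) (IProv.andE1 (.ax (.inl rfl)))).tau_eq_intro
      (ht.graph (fun _ h => .inr (.inr h)) (IProv.andE2 (.ax (.inl rfl))))
  | .and A B, Γ, σ, π, h, hA => by
    simp only [DForm.subst, tau] at hA ⊢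
    exact IProv.andI
      (IProv.tau_subst_mono A (h.mono fun i hi => by
        simp only [DForm.Iotable] at hi; exact hi.1) hA.andE1)
      (IProv.tau_subst_mono B (h.mono fun i hi => by
        simp only [DForm.Iotable] at hi; exact hi.2) hA.andE2)
  | .or A B, Γ, σ, π, h, hA => by
    simp only [DForm.subst, tau] at hA ⊢
    exact IProv.orE hA
      (IProv.orI1 (IProv.tau_subst_mono A ((h.mono fun i hi => by
        simp only [DForm.Iotable] at hi; exact hi.1).weaken (Set.subset_insert _ _))
          (.ax (.inl rfl))))
      (IProv.orI2 (IProv.tau_subst_mono B ((h.mono fun i hi => by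
        simp only [DForm.Iotable] at hi; exact hi.2).weaken (Set.subset_insert _ _))
          (.ax (.inl rfl))))
  | .imp A B, Γ, σ, π, h, hA => by
    simp only [DForm.subst, tau] at hA ⊢
    refine IProv.impI (IProv.tau_subst_mono B ((h.mono fun i hi => by
        simp only [DForm.Iotable] at hi; exact hi.2).weaken (Set.subset_insert _ _))
      (IProv.impE (hA.weaken (Set.subset_insert _ _)) ?_))
    exact IProv.tau_subst_mono A ((h.symm.mono fun i hi => by
        simp only [DForm.Iotable] at hi; exact hi.1).weaken (Set.subset_insert _ _))
          (.ax (.inl rfl))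
  | .all A, Γ, σ, π, h, hA => by
    simp only [DForm.subst, tau] at hA ⊢
    exact hA.all_mono (IProv.tau_subst_mono A (h.lift (fun i hi => by
      simpa only [DForm.Iotable] using hi) fun _ h => .inr (.inr h)) (.ax (.inl rfl)))
  | .ex A, Γ, σ, π, h, hA => by
    simp only [DForm.subst, tau] at hA ⊢
    exact hA.ex_mono (IProv.tau_subst_mono A (h.lift (fun i hi => by
      simpa only [DForm.Iotable] using hi) fun _ h => .inr (.inr h)) (.ax (.inl rfl)))
  | .delta B t, Γ, σ, π, h, hA => by
    simp only [DForm.subst] at hA ⊢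
    have ht := Codenotes.subst t (h.mono fun i hi => by
      simp only [DForm.Iotable] at hi; exact hi.2)
    refine hA.tau_delta_elim.exE ?_
    rw [← tau_shift]
    simp only [DForm.shift, DForm.rename]
    refine (ht.graph (fun _ h => .inr (.inr h)) (IProv.andE1 (.ax (.inl rfl)))).tau_delta_intro ?_
    rw [tau_rename, rename_liftRen_succ_inst_zero]
    exact IProv.tau_subst_mono B (h.lift (fun i hi => by
      simp only [DForm.Iotable] at hi; exact hi.1) fun _ h => .inr (.inr h))
      (IProv.andE2 (.ax (.inl rfl)))

end

end Codenotation

section AbstractionSyntax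

variable {L : FirstOrder.Language.{u, v}}

theorem term_subst_relabel (t : L.Term ℕ) (ρ : ℕ → ℕ) (σ : ℕ → L.Term ℕ) :
    (t.relabel ρ).subst σ = t.subst fun i => σ (ρ i) := by
  rw [term_relabel_eq_subst, term_subst_subst]
  rfl

theorem term_relabel_subst (t : L.Term ℕ) (ρ : ℕ → ℕ) (σ : ℕ → L.Term ℕ) :
    (t.subst σ).relabel ρ = t.subst fun i => (σ i).relabel ρ := by
  simp only [term_relabel_eq_subst, term_subst_subst]

theorem liftDSub_comp_liftRen (ρ : ℕ → ℕ) (σ : ℕ → DTerm L) :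
    (fun i => liftDSub σ (liftRen ρ i)) = liftDSub fun i => σ (ρ i) := by
  funext i
  cases i <;> rfl

theorem liftDSub_var : liftDSub (DTerm.var : ℕ → DTerm L) = DTerm.var := by
  funext i
  cases i with
  | zero => rfl
  | succ i => simp only [liftDSub, DTerm.shift, DTerm.var, DTerm.rename, Term.relabel]

mutual

theorem DTerm.rename_subst : (t : DTerm L) → (ρ : ℕ → ℕ) → (σ : ℕ → DTerm L) →
    (t.rename ρ).subst σ = t.subst fun i => σ (ρ i)
  | .ord (.var i), ρ, σ => by simp only [DTerm.rename, Term.relabel, DTerm.subst]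
  | .ord (.func f ts), ρ, σ => by
    simp only [DTerm.rename, Term.relabel, DTerm.subst, Term.subst, term_subst_relabel]
  | .iota A, ρ, σ => by
    simp only [DTerm.rename, DTerm.subst, DForm.rename_subst A, liftDSub_comp_liftRen]

theorem DForm.rename_subst : (A : DForm L) → (ρ : ℕ → ℕ) → (σ : ℕ → DTerm L) →
    (A.rename ρ).subst σ = A.subst fun i => σ (ρ i)
  | .falsum, _, _ => rfl
  | .rel R ts, ρ, σ => by simp only [DForm.rename, DForm.subst, term_subst_relabel]
  | .exi t, ρ, σ => by simp only [DForm.rename, DForm.subst, DTerm.rename_subst t]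
  | .eq s t, ρ, σ => by
    simp only [DForm.rename, DForm.subst, DTerm.rename_subst s, DTerm.rename_subst t]
  | .and A B, ρ, σ => by
    simp only [DForm.rename, DForm.subst, DForm.rename_subst A, DForm.rename_subst B]
  | .or A B, ρ, σ => by
    simp only [DForm.rename, DForm.subst, DForm.rename_subst A, DForm.rename_subst B]
  | .imp A B, ρ, σ => by
    simp only [DForm.rename, DForm.subst, DForm.rename_subst A, DForm.rename_subst B]
  | .all A, ρ, σ => by
    simp only [DForm.rename, DForm.subst, DForm.rename_subst A, liftDSub_comp_liftRen]
  | .ex A, ρ, σ => by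
    simp only [DForm.rename, DForm.subst, DForm.rename_subst A, liftDSub_comp_liftRen]
  | .delta B t, ρ, σ => by
    simp only [DForm.rename, DForm.subst, DForm.rename_subst B, DTerm.rename_subst t,
      liftDSub_comp_liftRen]

end

mutual

theorem DTerm.subst_var : (t : DTerm L) → t.subst DTerm.var = t
  | .ord t => by
    have := DTerm.ord_subst_ord Term.var t
    rwa [term_subst_var] at this
  | .iota A => by simp only [DTerm.subst, liftDSub_var, DForm.subst_var A]

theorem DForm.subst_var : (A : DForm L) → A.subst DTerm.var = A
  | .falsum => rfl
  | .rel R ts => by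
    simp only [DForm.subst]
    congr 1
    funext k
    exact term_subst_var (ts k)
  | .exi t => by simp only [DForm.subst, DTerm.subst_var t]
  | .eq s t => by simp only [DForm.subst, DTerm.subst_var s, DTerm.subst_var t]
  | .and A B => by simp only [DForm.subst, DForm.subst_var A, DForm.subst_var B]
  | .or A B => by simp only [DForm.subst, DForm.subst_var A, DForm.subst_var B]
  | .imp A B => by simp only [DForm.subst, DForm.subst_var A, DForm.subst_var B]
  | .all A => by simp only [DForm.subst, liftDSub_var, DForm.subst_var A]
  | .ex A => by simp only [DForm.subst, liftDSub_var, DForm.subst_var A]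
  | .delta B t => by
    simp only [DForm.subst, liftDSub_var, DForm.subst_var B, DTerm.subst_var t]

end

/-- Renaming after the substitution `σ` is the substitution `π`, as far as ordinary terms are put
for the variables that do not satisfy `P`. -/
def RenameRel (P : ℕ → Prop) (ρ : ℕ → ℕ) (σ π : ℕ → DTerm L) : Prop :=
  ∀ i, (σ i).rename ρ = π i ∧ (P i ∨ ∃ t, σ i = .ord t)

namespace RenameRel

variable {P Q : ℕ → Prop} {ρ : ℕ → ℕ} {σ π : ℕ → DTerm L}

theorem mono (h : RenameRel P ρ σ π) (hP : ∀ i, P i → Q i) : RenameRel Q ρ σ π := fun i =>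
  ⟨(h i).1, (h i).2.imp_left (hP i)⟩

theorem toTerm_subst (h : RenameRel P ρ σ π) (t : L.Term ℕ) (hP : ∀ i, P i → i ∉ t.varFinset) :
    (t.subst fun i => (σ i).toTerm).relabel ρ = t.subst fun i => (π i).toTerm := by
  rw [term_relabel_subst]
  refine term_subst_congr t fun i hi => ?_
  obtain ⟨h1, h2 | ⟨s, hs⟩⟩ := h i
  · exact (hP i h2 hi).elim
  · rw [← h1, hs]
    simp only [DTerm.rename, DTerm.toTerm]

end RenameRel

theorem liftRen_comp (ρ π : ℕ → ℕ) :
    (fun i => liftRen π (liftRen ρ i)) = liftRen fun i => π (ρ i) := by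
  funext i
  cases i <;> rfl

mutual

theorem DTerm.rename_rename : (t : DTerm L) → (ρ π : ℕ → ℕ) →
    (t.rename ρ).rename π = t.rename fun i => π (ρ i)
  | .ord t, ρ, π => by
    simp only [DTerm.rename, term_relabel_eq_subst, term_subst_subst, Term.subst]
  | .iota A, ρ, π => by
    simp only [DTerm.rename, DForm.rename_rename A, liftRen_comp]

theorem DForm.rename_rename : (A : DForm L) → (ρ π : ℕ → ℕ) →
    (A.rename ρ).rename π = A.rename fun i => π (ρ i)
  | .falsum, _, _ => rfl
  | .rel R ts, ρ, π => by
    simp only [DForm.rename, term_relabel_eq_subst, term_subst_subst, Term.subst]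
  | .exi t, ρ, π => by simp only [DForm.rename, DTerm.rename_rename t]
  | .eq s t, ρ, π => by simp only [DForm.rename, DTerm.rename_rename s, DTerm.rename_rename t]
  | .and A B, ρ, π => by simp only [DForm.rename, DForm.rename_rename A, DForm.rename_rename B]
  | .or A B, ρ, π => by simp only [DForm.rename, DForm.rename_rename A, DForm.rename_rename B]
  | .imp A B, ρ, π => by simp only [DForm.rename, DForm.rename_rename A, DForm.rename_rename B]
  | .all A, ρ, π => by simp only [DForm.rename, DForm.rename_rename A, liftRen_comp]
  | .ex A, ρ, π => by simp only [DForm.rename, DForm.rename_rename A, liftRen_comp]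
  | .delta B t, ρ, π => by
    simp only [DForm.rename, DForm.rename_rename B, DTerm.rename_rename t, liftRen_comp]

end

theorem RenameRel.lift {P Q : ℕ → Prop} {ρ : ℕ → ℕ} {σ π : ℕ → DTerm L} (h : RenameRel P ρ σ π)
    (hP : ∀ i, P i → Q (i + 1)) : RenameRel Q (liftRen ρ) (liftDSub σ) (liftDSub π) := by
  intro i
  cases i with
  | zero =>
    refine ⟨?_, .inr ⟨_, rfl⟩⟩
    simp only [liftDSub, DTerm.var, DTerm.rename, Term.relabel, liftRen]
  | succ i =>
    obtain ⟨h1, h2⟩ := h i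
    refine ⟨?_, h2.imp (hP i) ?_⟩
    · simp only [liftDSub, ← h1, DTerm.shift, DTerm.rename_rename]
      rfl
    · rintro ⟨t, ht⟩
      refine ⟨t.relabel Nat.succ, ?_⟩
      simp only [liftDSub, ht, DTerm.shift, DTerm.rename]

mutual

theorem DTerm.subst_rename : (t : DTerm L) → ∀ {ρ : ℕ → ℕ} {σ π : ℕ → DTerm L},
    RenameRel (fun i => t.Iotable i) ρ σ π → (t.subst σ).rename ρ = t.subst π
  | .ord (.var i), ρ, σ, π, h => by
    simp only [DTerm.subst]
    exact (h i).1
  | .ord (.func f ts), ρ, σ, π, h => by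
    simp only [DTerm.subst, DTerm.rename]
    rw [h.toTerm_subst _ fun i hi => by simpa only [DTerm.Iotable] using hi]
  | .iota A, ρ, σ, π, h => by
    simp only [DTerm.subst, DTerm.rename]
    rw [DForm.subst_rename A (h.lift fun i hi => by simpa only [DTerm.Iotable] using hi)]

theorem DForm.subst_rename : (A : DForm L) → ∀ {ρ : ℕ → ℕ} {σ π : ℕ → DTerm L},
    RenameRel (fun i => A.Iotable i) ρ σ π → (A.subst σ).rename ρ = A.subst π
  | .falsum, ρ, σ, π, h => rfl
  | .rel R ts, ρ, σ, π, h => by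
    simp only [DForm.subst, DForm.rename]
    congr 1
    funext k
    exact h.toTerm_subst _ fun i hi => by
      simp only [DForm.Iotable] at hi
      exact hi k
  | .exi t, ρ, σ, π, h => by
    simp only [DForm.subst, DForm.rename]
    rw [DTerm.subst_rename t (h.mono fun i hi => by simpa only [DForm.Iotable] using hi)]
  | .eq s t, ρ, σ, π, h => by
    simp only [DForm.subst, DForm.rename]
    simp only [DForm.Iotable] at h
    rw [DTerm.subst_rename s (h.mono fun i hi => hi.1),
      DTerm.subst_rename t (h.mono fun i hi => hi.2)]
  | .and A B, ρ, σ, π, h => by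
    simp only [DForm.subst, DForm.rename]
    simp only [DForm.Iotable] at h
    rw [DForm.subst_rename A (h.mono fun i hi => hi.1),
      DForm.subst_rename B (h.mono fun i hi => hi.2)]
  | .or A B, ρ, σ, π, h => by
    simp only [DForm.subst, DForm.rename]
    simp only [DForm.Iotable] at h
    rw [DForm.subst_rename A (h.mono fun i hi => hi.1),
      DForm.subst_rename B (h.mono fun i hi => hi.2)]
  | .imp A B, ρ, σ, π, h => by
    simp only [DForm.subst, DForm.rename]
    simp only [DForm.Iotable] at h
    rw [DForm.subst_rename A (h.mono fun i hi => hi.1),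
      DForm.subst_rename B (h.mono fun i hi => hi.2)]
  | .all A, ρ, σ, π, h => by
    simp only [DForm.subst, DForm.rename]
    simp only [DForm.Iotable] at h
    rw [DForm.subst_rename A (h.lift fun i hi => hi)]
  | .ex A, ρ, σ, π, h => by
    simp only [DForm.subst, DForm.rename]
    simp only [DForm.Iotable] at h
    rw [DForm.subst_rename A (h.lift fun i hi => hi)]
  | .delta B t, ρ, σ, π, h => by
    simp only [DForm.subst, DForm.rename]
    simp only [DForm.Iotable] at h
    rw [DForm.subst_rename B (h.lift fun i hi => hi.1),
      DTerm.subst_rename t (h.mono fun i hi => hi.2)]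

end

end AbstractionSyntax

section TauSound

open IForm

variable {L : FirstOrder.Language.{u, v}} {Γ Δ : Set (IForm L)}

namespace IProv

/-- What holds of a term that denotes the variable `0` holds of that variable, and conversely. -/
theorem tau_inst_shift_iff {A : DForm L} {t : DTerm L} (hA : A.Admits t)
    (ht : IProv Δ (graph t)) : IProv Δ (tau (A.inst t)).shift ↔ IProv Δ (tau A) := by
  cases t with
  | ord t =>
    rw [tau_inst_ord, shift, inst_rename]
    constructor
    · intro h
      have := inst_of_eq (t := .var 0) ht h
      rwa [rename_liftRen_succ_inst_zero] at this
    · intro h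
      rw [← rename_liftRen_succ_inst_zero (tau A)] at h
      exact inst_of_eq ht.eq_symm h
  | iota B =>
    have hπ : RenameRel (fun i => A.Iotable i) Nat.succ (dsingle (.iota B))
        (fun i => (dsingle (.iota B) i).shift) := by
      intro i
      cases i with
      | zero => exact ⟨rfl, .inl hA⟩
      | succ i => exact ⟨rfl, .inr ⟨_, rfl⟩⟩
    have hσ : SubstRel Δ (fun i => A.Iotable i) (fun i => (dsingle (.iota B) i).shift)
        DTerm.var := by
      intro i
      cases i with
      | zero => exact .inr ⟨hA, .of_denotes (u := .var 0) ht (eqI ht.exi_of_denotes)⟩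
      | succ i =>
        exact .inl (by simp only [dsingle, DTerm.shift, DTerm.var, DTerm.rename, Term.relabel])
    rw [← tau_shift, DForm.inst, DForm.shift, DForm.subst_rename A hπ]
    have h1 := tau_subst_mono A hσ
    have h2 := tau_subst_mono A hσ.symm
    rw [DForm.subst_var] at h1 h2
    exact ⟨h1, h2⟩

theorem iota_eq_iff {u : L.Term ℕ} (F : IForm L) (hu : IProv Γ (exi u)) :
    IProv Γ (IForm.iff (iota F (eq (.var 0) (tshift u)))
      (all (IForm.iff F (eq (.var 0) (tshift u))))) := by
  refine andI (impI (allI (andI (impI ?_) (impI ?_)))) (impI ?_)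
  · refine iota_uniq (ax (.inl rfl)) (fun _ h => .inr (.inr h)) (ax (.inr (.inl rfl)))
      (ax (.inl rfl)) ((hu.weaken (Set.subset_insert _ _)).up fun _ h => .inr (.inr h)) ?_
    rw [tshift, ← inst_rename]
    exact (iota_eq_elim (ax (.inl rfl))).1.up fun _ h => .inr (.inr h)
  · have h : IProv (insert (iota F (eq (.var 0) (tshift u))) Γ) (F.inst u) :=
      (iota_eq_elim (ax (.inl rfl))).1
    have h := h.up (Δ := insert (eq (.var 0) (tshift u)) (insert (exi (.var 0))
      (shift '' insert (iota F (eq (.var 0) (tshift u))) Γ))) fun _ h => .inr (.inr h)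
    rw [shift, inst_rename] at h
    have h := inst_of_eq (t := .var 0) (eq_symm (ax (.inl rfl))) h
    rwa [rename_liftRen_succ_inst_zero] at h
  · have hu' := hu.weaken (Set.subset_insert (all (IForm.iff F (eq (.var 0) (tshift u)))) Γ)
    have hF := iff_mpr (allE u (ax (.inl rfl)) hu') (by
      simpa only [inst, subst, Term.subst, single, tshift_subst_single] using eqI hu')
    refine iotaI u hF ?_ hu' ?_
    · simpa only [inst, subst, Term.subst, single, tshift_subst_single] using eqI hu'
    · exact iff_mp (all_up (ax (.inl rfl)) (fun _ h => .inr (.inr h)) (ax (.inr (.inl rfl))))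
        (ax (.inl rfl))

theorem tau_lambert (F : DForm L) : IProv Γ (tau (.lambert F)) :=
  allI (iota_eq_iff (u := .var 0) (tau F) (ax (.inl rfl)))

theorem tau_absTerm (B : DForm L) (t : DTerm L) (hB : B.Admits t) :
    IProv Γ (tau (.absTerm B t)) := by
  refine andI (impI ?_) (impI ?_)
  · refine (tau_delta_elim (ax (.inl rfl))).exE (andI ?_ ?_)
    · rw [← IForm.shift, ← tau_shift]
      exact tau_exi_intro (andE1 (ax (.inl rfl)))
    · rw [← IForm.shift, tau_inst_shift_iff hB (andE1 (ax (.inl rfl)))]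
      exact andE2 (ax (.inl rfl))
  · refine (tau_exi_elim (andE1 (ax (.inl rfl)))).exE ?_
    rw [← tau_shift]
    simp only [DForm.shift, DForm.rename]
    refine tau_delta_intro (ax (.inl rfl)) ?_
    rw [tau_rename, rename_liftRen_succ_inst_zero, ← tau_inst_shift_iff hB (ax (.inl rfl))]
    exact andE2 (ax (.inr (.inr ⟨_, .inl rfl, rfl⟩)))

theorem tau_absIota (A B : DForm L) : IProv Γ (tau (.absIota A B)) := by
  refine andI (impI (tau_delta_elim (B := B) (t := .iota A) (ax (.inl rfl)))) (impI ?_)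
  refine exE (A := and (graph (.iota A)) (tau B)) (ax (.inl rfl)) ?_
  rw [← tau_shift]
  simp only [DForm.shift, DForm.rename]
  refine tau_delta_intro (andE1 (ax (.inl rfl))) ?_
  rw [tau_rename, rename_liftRen_succ_inst_zero]
  exact andE2 (ax (.inl rfl))

end IProv

theorem tau_image_shift (Γ : Set (DForm L)) :
    tau '' (DForm.shift '' Γ) = shift '' (tau '' Γ) := by
  simp only [Set.image_image, tau_shift]

theorem DProv.tau {Γ : Set (DForm L)} {A : DForm L} (h : DProv Γ A) :
    IProv (tau '' Γ) (tau A) := by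
  induction h with
  | ax h => exact .ax ⟨_, h, rfl⟩
  | andI _ _ ih1 ih2 => exact .andI ih1 ih2
  | andE1 _ ih => exact .andE1 ih
  | andE2 _ ih => exact .andE2 ih
  | impI _ ih =>
    rw [Set.image_insert_eq] at ih
    exact .impI ih
  | impE _ _ ih1 ih2 => exact .impE ih1 ih2
  | orI1 _ ih => exact .orI1 ih
  | orI2 _ ih => exact .orI2 ih
  | orE _ _ _ ih ih1 ih2 =>
    rw [Set.image_insert_eq] at ih1 ih2
    exact .orE ih ih1 ih2
  | falsumE _ _ ih => exact ih.falsum_elim _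
  | allI _ ih =>
    rw [Set.image_insert_eq, tau_image_shift] at ih
    exact .allI ih
  | allE t hA _ _ ih1 ih2 =>
    refine ih2.tau_exi_elim.exE ?_
    rw [IProv.tau_inst_shift_iff hA (.ax (.inl rfl))]
    exact ih1.all_up (fun _ h => .inr (.inr h)) (.ax (.inr (.inl rfl)))
  | exI t hA _ _ ih1 ih2 =>
    refine ih2.tau_exi_elim.exE (IProv.ex_shift_intro ?_ (.ax (.inr (.inl rfl))))
    rw [← IProv.tau_inst_shift_iff hA (.ax (.inl rfl))]
    exact ih1.up fun _ h => .inr (.inr h)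
  | exE _ _ ih1 ih2 =>
    rw [Set.image_insert_eq, Set.image_insert_eq, tau_image_shift, tau_shift] at ih2
    exact .exE ih1 ih2
  | eqI _ ih =>
    refine ih.tau_exi_elim.exE ?_
    rw [← tau_shift]
    exact IProv.tau_eq_intro (.ax (.inl rfl)) (.ax (.inl rfl))
  | eqE _ hs ht _ _ ih1 ih2 =>
    refine ih1.tau_eq_elim.exE ?_
    rw [IProv.tau_inst_shift_iff ht (.andE2 (.ax (.inl rfl))),
      ← IProv.tau_inst_shift_iff hs (.andE1 (.ax (.inl rfl)))]
    exact ih2.up fun _ h => .inr (.inr h)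
  | adRel i _ ih => exact .adRel i ih
  | adEq1 _ ih =>
    refine ih.tau_eq_elim.exE ?_
    rw [← tau_shift]
    exact IProv.tau_exi_intro (.andE1 (.ax (.inl rfl)))
  | adEq2 _ ih =>
    refine ih.tau_eq_elim.exE ?_
    rw [← tau_shift]
    exact IProv.tau_exi_intro (.andE2 (.ax (.inl rfl)))
  | lambert F => exact .tau_lambert F
  | absTerm B t hB => exact .tau_absTerm B t hB
  | absIota A B => exact .tau_absIota A B

end TauSound

section UpsilonSyntax

variable {L : FirstOrder.Language.{u, v}}

theorem upsilon_subst (A : IForm L) (σ : ℕ → L.Term ℕ) :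
    upsilon (A.subst σ) = (upsilon A).subst fun i => .ord (σ i) := by
  induction A generalizing σ with
  | falsum => rfl
  | rel R ts => rfl
  | exi t => simp only [upsilon, IForm.subst, DForm.subst, DTerm.ord_subst_ord]
  | eq s t => simp only [upsilon, IForm.subst, DForm.subst, DTerm.ord_subst_ord]
  | iota F G ihF ihG =>
    simp only [upsilon, IForm.subst, DForm.subst, DTerm.subst, liftDSub_ord, ihF, ihG]
  | _ => simp_all only [upsilon, IForm.subst, DForm.subst, liftDSub_ord]

theorem upsilon_rename (A : IForm L) (ρ : ℕ → ℕ) :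
    upsilon (A.rename ρ) = (upsilon A).rename ρ := by
  induction A generalizing ρ <;>
    simp_all only [upsilon, IForm.rename, DForm.rename, DTerm.rename]

theorem upsilon_shift (A : IForm L) : upsilon A.shift = (upsilon A).shift := upsilon_rename A _

theorem upsilon_inst (A : IForm L) (t : L.Term ℕ) :
    upsilon (A.inst t) = (upsilon A).inst (.ord t) := by
  rw [IForm.inst, upsilon_subst, DForm.inst, dsingle_ord]

theorem upsilon_image_shift (Γ : Set (IForm L)) :
    upsilon '' (IForm.shift '' Γ) = DForm.shift '' (upsilon '' Γ) := by
  simp only [Set.image_image, upsilon_shift]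

theorem DForm.rename_liftRen_succ_inst_zero (A : DForm L) :
    (A.rename (liftRen Nat.succ)).inst (.var 0) = A := by
  rw [DForm.inst, DForm.rename_subst]
  convert A.subst_var using 2
  funext i
  cases i <;> rfl

theorem DForm.rename_liftRen_succ_subst_single (A : DForm L) (t : L.Term ℕ) :
    (A.rename (liftRen Nat.succ)).subst (liftDSub (dsingle (.ord t))) = A := by
  rw [DForm.rename_subst]
  convert A.subst_var using 2
  funext i
  cases i with
  | zero => rfl
  | succ i =>
    simp only [liftRen, liftDSub, dsingle, DTerm.shift, DTerm.var, DTerm.rename, Term.relabel]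

theorem IForm.IsAtomic.upsilon {A : IForm L} (h : A.IsAtomic) : (upsilon A).IsAtomic := by
  cases A <;> exact h

end UpsilonSyntax

namespace DProv

open DForm

variable {L : FirstOrder.Language.{u, v}} {Γ Δ : Set (DForm L)} {A B C F G : DForm L}
  {r s t : L.Term ℕ}

theorem weaken (h : DProv Γ A) (hΔ : Γ ⊆ Δ) : DProv Δ A := by
  induction h generalizing Δ with
  | ax h => exact ax (hΔ h)
  | andI _ _ ih1 ih2 => exact andI (ih1 hΔ) (ih2 hΔ)
  | andE1 _ ih => exact andE1 (ih hΔ)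
  | andE2 _ ih => exact andE2 (ih hΔ)
  | impI _ ih => exact impI (ih (Set.insert_subset_insert hΔ))
  | impE _ _ ih1 ih2 => exact impE (ih1 hΔ) (ih2 hΔ)
  | orI1 _ ih => exact orI1 (ih hΔ)
  | orI2 _ ih => exact orI2 (ih hΔ)
  | orE _ _ _ ih ih1 ih2 =>
    exact orE (ih hΔ) (ih1 (Set.insert_subset_insert hΔ)) (ih2 (Set.insert_subset_insert hΔ))
  | falsumE ha _ ih => exact falsumE ha (ih hΔ)
  | allI _ ih => exact allI (ih (Set.insert_subset_insert (Set.image_mono hΔ)))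
  | allE t ha _ _ ih1 ih2 => exact allE t ha (ih1 hΔ) (ih2 hΔ)
  | exI t ha _ _ ih1 ih2 => exact exI t ha (ih1 hΔ) (ih2 hΔ)
  | exE _ _ ih1 ih2 =>
    exact exE (ih1 hΔ)
      (ih2 (Set.insert_subset_insert (Set.insert_subset_insert (Set.image_mono hΔ))))
  | eqI _ ih => exact eqI (ih hΔ)
  | eqE ha hs ht _ _ ih1 ih2 => exact eqE ha hs ht (ih1 hΔ) (ih2 hΔ)
  | adRel i _ ih => exact adRel i (ih hΔ)
  | adEq1 _ ih => exact adEq1 (ih hΔ)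
  | adEq2 _ ih => exact adEq2 (ih hΔ)
  | lambert F => exact lambert F
  | absTerm B t hB => exact absTerm B t hB
  | absIota A B => exact absIota A B

theorem cut (h : DProv Γ A) (h' : DProv (insert A Γ) B) : DProv Γ B :=
  impE (impI h') h

theorem eq_symm (h : DProv Γ (eq (.ord s) (.ord t))) : DProv Γ (eq (.ord t) (.ord s)) := by
  have key : ∀ r, (eq (.var 0) (.ord (tshift s))).inst (.ord r) = eq (.ord r) (.ord s) := by
    intro r
    have := upsilon_inst (.eq (.var 0) (tshift s)) r
    simp only [IForm.inst, IForm.subst, tshift_subst_single] at this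
    exact this.symm
  rw [← key]
  refine eqE (s := .ord s) trivial trivial trivial h ?_
  rw [key]
  exact eqI (adEq1 h)

theorem eq_trans (h : DProv Γ (eq (.ord s) (.ord t))) (h' : DProv Γ (eq (.ord t) (.ord r))) :
    DProv Γ (eq (.ord s) (.ord r)) := by
  have key : ∀ r, (eq (.ord (tshift s)) (.var 0)).inst (.ord r) = eq (.ord s) (.ord r) := by
    intro r
    have := upsilon_inst (.eq (tshift s) (.var 0)) r
    simp only [IForm.inst, IForm.subst, tshift_subst_single] at this
    exact this.symm
  rw [← key]
  refine eqE (s := .ord t) trivial trivial trivial h' ?_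
  rwa [key]

theorem all_zero (h : DProv Δ (all A).shift) (h0 : DProv Δ (exi (.var 0))) : DProv Δ A := by
  have := allE (.var 0) trivial h h0
  rwa [rename_liftRen_succ_inst_zero] at this

theorem ex_shift_intro (h : DProv Δ A) (h0 : DProv Δ (exi (.var 0))) : DProv Δ (ex A).shift := by
  refine exI (.var 0) trivial ?_ h0
  rwa [rename_liftRen_succ_inst_zero]

theorem ex_mono (h : DProv Γ (ex A))
    (hAB : DProv (insert A (insert (exi (.var 0)) (shift '' Γ))) B) : DProv Γ (ex B) :=
  exE h (ex_shift_intro hAB (ax (.inr (.inl rfl))))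

theorem iota_eq_iff (h : DProv Γ (exi (.ord t))) :
    DProv Γ (DForm.iff (eq (.iota A) (.ord t))
      (all (DForm.iff A (eq (.var 0) (.ord (tshift t)))))) := by
  have := allE (.ord t) trivial (lambert (A.rename (liftRen Nat.succ))) h
  have key : (DForm.iff (eq (.iota (A.rename (liftRen Nat.succ))) (.var 0))
      (all (DForm.iff (A.rename (liftRen Nat.succ)) (eq (.var 0) (.var 1))))).inst (.ord t) =
      DForm.iff (eq (.iota A) (.ord t)) (all (DForm.iff A (eq (.var 0) (.ord (tshift t))))) := by
    simp only [inst, DForm.iff, DForm.subst, DTerm.subst, rename_liftRen_succ_subst_single,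
      DTerm.var, dsingle, liftDSub, DTerm.shift, DTerm.rename, tshift]
  rwa [key] at this

theorem iota_eq_elim (h : DProv Γ (eq (.iota A) (.ord t))) (hs : DProv Γ (exi (.ord s))) :
    DProv Γ (DForm.iff (A.inst (.ord s)) (eq (.ord s) (.ord t))) := by
  have := allE (.ord s) trivial (impE (andE1 (iota_eq_iff (adEq2 h))) h) hs
  have key : (DForm.iff A (eq (.var 0) (.ord (tshift t)))).inst (.ord s) =
      DForm.iff (A.inst (.ord s)) (eq (.ord s) (.ord t)) := by
    simp only [inst, DForm.iff, DForm.subst, dsingle_ord, DTerm.ord_subst_ord, DTerm.var,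
      tshift_subst_single]
    rfl
  rwa [key] at this

theorem atomic_subst_of_eq {A : IForm L} (hA : A.IsAtomic) {σ π : ℕ → L.Term ℕ} (n : ℕ)
    (hne : ∀ i ≠ n, σ i = π i) (he : DProv Γ (eq (.ord (σ n)) (.ord (π n))))
    (h : DProv Γ (upsilon (A.subst σ))) : DProv Γ (upsilon (A.subst π)) := by
  obtain ⟨κ, hσ, hπ⟩ := exists_subst_single_eq n hne
  rw [← funext hσ, ← IForm.subst_subst, ← IForm.inst, upsilon_inst] at h
  rw [← funext hπ, ← IForm.subst_subst, ← IForm.inst, upsilon_inst]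
  exact eqE (s := .ord (σ n)) (hA.subst _).upsilon trivial trivial he h

theorem iota_subst_of_eq {A : IForm L} {σ π : ℕ → L.Term ℕ} (n : ℕ)
    (hne : ∀ i ≠ n, σ i = π i) (he : DProv Γ (eq (.ord (σ n)) (.ord (π n))))
    (h : DProv Γ (eq (.iota (upsilon (A.subst (liftSub σ)))) (.ord t))) :
    DProv Γ (eq (.iota (upsilon (A.subst (liftSub π)))) (.ord t)) := by
  obtain ⟨κ, hσ, hπ⟩ := exists_subst_single_eq n hne
  have key : ∀ s, (eq (.iota (upsilon (A.subst (liftSub κ)))) (.ord (tshift t))).inst (.ord s) =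
      eq (.iota (upsilon (A.subst (liftSub fun i => (κ i).subst (single s))))) (.ord t) := by
    intro s
    simp only [inst, DForm.subst, DTerm.iota_subst, dsingle_ord, DTerm.ord_subst_ord,
      liftDSub_ord, ← upsilon_subst, IForm.subst_subst, liftSub_comp, tshift_subst_single]
  rw [← funext hσ, ← key] at h
  rw [← funext hπ, ← key]
  exact eqE (s := .ord (σ n)) trivial trivial trivial he h

theorem eq_mem_shift (h : eq (.ord s) (.ord t) ∈ Γ) :
    eq (.ord (tshift s)) (.ord (tshift t)) ∈ shift '' Γ :=
  ⟨_, h, by simp only [DForm.shift, DForm.rename, DTerm.rename, tshift]⟩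

/-- Leibniz' Law for translated formulas, for two substitutions that differ in one variable. -/
theorem upsilon_subst_of_eq (A : IForm L) {σ π : ℕ → L.Term ℕ} (n : ℕ)
    (hne : ∀ i ≠ n, σ i = π i) (he : eq (.ord (σ n)) (.ord (π n)) ∈ Γ)
    (he' : eq (.ord (π n)) (.ord (σ n)) ∈ Γ) :
    DProv Γ (imp (upsilon (A.subst σ)) (upsilon (A.subst π))) := by
  induction A generalizing Γ σ π n with
  | falsum => exact impI (ax (.inl rfl))
  | rel R ts =>
    exact impI (atomic_subst_of_eq (A := .rel R ts) trivial n hne (ax (.inr he)) (ax (.inl rfl)))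
  | exi t =>
    exact impI (atomic_subst_of_eq (A := .exi t) trivial n hne (ax (.inr he)) (ax (.inl rfl)))
  | eq s t =>
    exact impI (atomic_subst_of_eq (A := .eq s t) trivial n hne (ax (.inr he)) (ax (.inl rfl)))
  | and A B ihA ihB =>
    exact impI (andI (impE (ihA n hne (.inr he) (.inr he')) (andE1 (ax (.inl rfl))))
      (impE (ihB n hne (.inr he) (.inr he')) (andE2 (ax (.inl rfl)))))
  | or A B ihA ihB =>
    exact impI (orE (ax (.inl rfl))
      (orI1 (impE (ihA n hne (.inr (.inr he)) (.inr (.inr he'))) (ax (.inl rfl))))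
      (orI2 (impE (ihB n hne (.inr (.inr he)) (.inr (.inr he'))) (ax (.inl rfl)))))
  | imp A B ihA ihB =>
    exact impI (impI (impE (ihB n hne (.inr (.inr he)) (.inr (.inr he')))
      (impE (ax (.inr (.inl rfl))) (impE (ihA n (fun i hi => (hne i hi).symm)
        (.inr (.inr he')) (.inr (.inr he))) (ax (.inl rfl))))))
  | all A ih =>
    exact impI (allI (impE (ih (n + 1) (liftSub_eq_of_ne hne)
      (.inr (eq_mem_shift (.inr he))) (.inr (eq_mem_shift (.inr he'))))
      (all_zero (ax (.inr ⟨_, .inl rfl, rfl⟩)) (ax (.inl rfl)))))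
  | ex A ih =>
    exact impI (ex_mono (ax (.inl rfl)) (impE (ih (n + 1) (liftSub_eq_of_ne hne)
      (.inr (.inr (eq_mem_shift (.inr he)))) (.inr (.inr (eq_mem_shift (.inr he')))))
      (ax (.inl rfl))))
  | iota F G ihF ihG =>
    have key : ∀ σ : ℕ → L.Term ℕ, (DTerm.iota (upsilon (F.subst (liftSub σ)))).shift =
        .iota (upsilon (F.subst (liftSub fun i => tshift (σ i)))) := by
      intro σ
      simp only [DTerm.shift, DTerm.rename, ← upsilon_rename, IForm.rename_eq_subst,
        IForm.subst_subst]
      congr 3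
      funext i
      cases i with
      | zero => rfl
      | succ i =>
        simp only [liftSub, tshift_eq_subst, term_subst_subst, Term.subst, liftRen]
    refine impI (impE (andE2 (absIota _ _)) (ex_mono
      (impE (andE1 (absIota (upsilon (F.subst (liftSub σ))) _)) (ax (.inl rfl)))
      (andI ?_ (impE (ihG (n + 1) (liftSub_eq_of_ne hne) (.inr (.inr (eq_mem_shift (.inr he))))
        (.inr (.inr (eq_mem_shift (.inr he'))))) (andE2 (ax (.inl rfl)))))))
    rw [key σ, key π]
    refine iota_subst_of_eq n (fun i hi => congrArg tshift (hne i hi)) ?_ ?_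
    · exact ax (.inr (.inr (eq_mem_shift (.inr he))))
    · exact andE1 (ax (.inl rfl))

theorem upsilon_inst_of_eq {A : IForm L} (h : DProv Γ (eq (.ord s) (.ord t)))
    (hA : DProv Γ (upsilon (A.inst s))) : DProv Γ (upsilon (A.inst t)) :=
  h.cut ((h.weaken (Set.subset_insert _ _)).eq_symm.cut
    (impE (upsilon_subst_of_eq A (σ := single s) (π := single t) 0
      (fun i hi => by cases i with
        | zero => exact (hi rfl).elim
        | succ i => rfl) (.inr (.inl rfl)) (.inl rfl))
      (hA.weaken fun _ h => .inr (.inr h))))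

theorem upsilon_iotaI {F G : IForm L} (hF : DProv Γ (upsilon (F.inst t)))
    (hG : DProv Γ (upsilon (G.inst t))) (ht : DProv Γ (exi (.ord t)))
    (hu : DProv (insert (upsilon F) (insert (exi (.var 0)) (shift '' Γ)))
      (eq (.var 0) (.ord (tshift t)))) : DProv Γ (upsilon (.iota F G)) := by
  have h1 : DProv Γ (all (imp (upsilon F) (eq (.var 0) (.ord (tshift t))))) := allI (impI hu)
  have h2 : DProv (insert (all (imp (upsilon F) (eq (.var 0) (.ord (tshift t)))))
      (insert (upsilon (F.inst t)) Γ))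
      (all (DForm.iff (upsilon F) (eq (.var 0) (.ord (tshift t))))) := by
    refine allI (andI ?_ (impI ?_))
    · exact all_zero (ax (.inr ⟨_, .inl rfl, rfl⟩)) (ax (.inl rfl))
    · have h := upsilon_inst_of_eq (Γ := insert (eq (.var 0) (.ord (tshift t)))
        (insert (exi (.var 0)) (shift '' insert (all (imp (upsilon F)
          (eq (.var 0) (.ord (tshift t))))) (insert (upsilon (F.inst t)) Γ))))
        (A := F.rename (liftRen Nat.succ)) (s := tshift t) (t := .var 0)
        (eq_symm (ax (.inl rfl)))
      rw [IForm.rename_liftRen_succ_inst_zero] at h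
      refine h ?_
      rw [tshift, ← IForm.inst_rename, upsilon_rename]
      exact ax (.inr (.inr ⟨_, .inr (.inl rfl), rfl⟩))
  have h3 := hF.cut ((h1.weaken (Set.subset_insert _ _)).cut h2)
  have h4 := impE (andE2 (iota_eq_iff ht)) h3
  refine impE (andE2 (absIota _ _)) (exI (.ord t) trivial ?_ ht)
  have key : (and (eq (DTerm.iota (upsilon F)).shift (.var 0)) (upsilon G)).inst (.ord t) =
      and (eq (.iota (upsilon F)) (.ord t)) (upsilon (G.inst t)) := by
    rw [upsilon_inst]
    simp only [inst, DForm.subst, DTerm.shift, DTerm.rename, DTerm.subst, DTerm.var,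
      rename_liftRen_succ_subst_single, dsingle]
  rw [key]
  exact andI h4 hG

theorem upsilon_iota_elim {F G : IForm L} (h : DProv Γ (upsilon (.iota F G))) :
    DProv Γ (ex (and (eq (DTerm.shift (.iota (upsilon F))) (.var 0)) (upsilon G))) :=
  impE (andE1 (absIota _ _)) h

theorem upsilon_iotaE1 {F G C : IForm L} (h : DProv Γ (upsilon (.iota F G)))
    (hC : DProv (insert (upsilon F) (insert (upsilon G) (insert (exi (.var 0)) (shift '' Γ))))
      (upsilon C).shift) : DProv Γ (upsilon C) := by
  refine (upsilon_iota_elim h).exE ?_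
  have hFG : DProv (insert (and (eq (DTerm.shift (.iota (upsilon F))) (.var 0)) (upsilon G))
      (insert (exi (.var 0)) (shift '' Γ)))
      (and (eq (DTerm.shift (.iota (upsilon F))) (.var 0)) (upsilon G)) := ax (.inl rfl)
  have h0 := adEq2 (andE1 hFG)
  have hF := impE (andE2 (iota_eq_elim (A := (upsilon F).rename (liftRen Nat.succ)) (t := .var 0)
    (andE1 hFG) h0)) (eqI h0)
  change DProv _ (((upsilon F).rename (liftRen Nat.succ)).inst (.var 0)) at hF
  rw [rename_liftRen_succ_inst_zero] at hF
  exact (andE2 hFG).cut ((hF.weaken (Set.subset_insert _ _)).cut (hC.weaken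
    (Set.insert_subset_insert (Set.insert_subset_insert (Set.subset_insert _ _)))))

theorem upsilon_iotaE2 {F G : IForm L} (h : DProv Γ (upsilon (.iota F G)))
    (hs : DProv Γ (exi (.ord s))) (ht : DProv Γ (exi (.ord t)))
    (hFs : DProv Γ (upsilon (F.inst s))) (hFt : DProv Γ (upsilon (F.inst t))) :
    DProv Γ (eq (.ord s) (.ord t)) := by
  have key : DProv Γ (imp (upsilon (.exi s)) (imp (upsilon (.exi t)) (imp (upsilon (F.inst s))
      (imp (upsilon (F.inst t)) (upsilon (.eq s t)))))) := by
    refine impI (impI (impI (impI ?_)))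
    refine (upsilon_iota_elim (F := F) (G := G)
      (h.weaken fun _ h => .inr (.inr (.inr (.inr h))))).exE ?_
    have hval : ∀ {Δ : Set (DForm L)} {t : L.Term ℕ},
        DProv Δ (eq (DTerm.shift (.iota (upsilon F))) (.var 0)) →
        DProv Δ (upsilon (.exi t)).shift → DProv Δ (upsilon (F.inst t)).shift →
        DProv Δ (eq (.ord (tshift t)) (.var 0)) := by
      intro Δ t h ht hF
      refine impE (andE1 (iota_eq_elim h ht)) ?_
      rw [← upsilon_shift, IForm.shift, IForm.inst_rename, upsilon_inst, upsilon_rename] at hF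
      exact hF
    rw [← upsilon_shift]
    refine (hval (t := s) (andE1 (ax (.inl rfl)))
      (ax (.inr (.inr ⟨_, .inr (.inr (.inr (.inl rfl))), rfl⟩)))
      (ax (.inr (.inr ⟨_, .inr (.inl rfl), rfl⟩)))).eq_trans (eq_symm ?_)
    exact hval (andE1 (ax (.inl rfl))) (ax (.inr (.inr ⟨_, .inr (.inr (.inl rfl)), rfl⟩)))
      (ax (.inr (.inr ⟨_, .inl rfl, rfl⟩)))
  exact impE (impE (impE (impE key hs) ht) hFs) hFt

end DProv

theorem IProv.upsilon {L : FirstOrder.Language.{u, v}} {Γ : Set (IForm L)} {A : IForm L}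
    (h : IProv Γ A) : DProv (upsilon '' Γ) (upsilon A) := by
  induction h with
  | ax h => exact .ax ⟨_, h, rfl⟩
  | andI _ _ ih1 ih2 => exact .andI ih1 ih2
  | andE1 _ ih => exact .andE1 ih
  | andE2 _ ih => exact .andE2 ih
  | impI _ ih =>
    rw [Set.image_insert_eq] at ih
    exact .impI ih
  | impE _ _ ih1 ih2 => exact .impE ih1 ih2
  | orI1 _ ih => exact .orI1 ih
  | orI2 _ ih => exact .orI2 ih
  | orE _ _ _ ih ih1 ih2 =>
    rw [Set.image_insert_eq] at ih1 ih2
    exact .orE ih ih1 ih2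
  | falsumE ha _ ih => exact .falsumE ha.upsilon ih
  | allI _ ih =>
    rw [Set.image_insert_eq, upsilon_image_shift] at ih
    exact .allI ih
  | allE t _ _ ih1 ih2 =>
    rw [upsilon_inst]
    exact .allE (.ord t) trivial ih1 ih2
  | exI t _ _ ih1 ih2 =>
    rw [upsilon_inst] at ih1
    exact .exI (.ord t) trivial ih1 ih2
  | exE _ _ ih1 ih2 =>
    rw [Set.image_insert_eq, Set.image_insert_eq, upsilon_image_shift, upsilon_shift] at ih2
    exact .exE ih1 ih2
  | eqI _ ih => exact .eqI ih
  | @eqE _ _ s t ha _ _ ih1 ih2 =>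
    rw [upsilon_inst] at ih2 ⊢
    exact .eqE (s := .ord s) (t := .ord t) ha.upsilon trivial trivial ih1 ih2
  | adRel i _ ih => exact .adRel i ih
  | adEq1 _ ih => exact .adEq1 ih
  | adEq2 _ ih => exact .adEq2 ih
  | iotaI t _ _ _ _ ih1 ih2 ih3 ih4 =>
    rw [Set.image_insert_eq, Set.image_insert_eq, upsilon_image_shift] at ih4
    exact DProv.upsilon_iotaI ih1 ih2 ih3 ih4
  | iotaE1 _ _ ih1 ih2 =>
    rw [Set.image_insert_eq, Set.image_insert_eq, Set.image_insert_eq, upsilon_image_shift,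
      upsilon_shift] at ih2
    exact DProv.upsilon_iotaE1 ih1 ih2
  | iotaE2 _ _ _ _ _ ih1 ih2 ih3 ih4 ih5 => exact DProv.upsilon_iotaE2 ih1 ih2 ih3 ih4 ih5

end FreeLogic

theorem theorem2 (L : FirstOrder.Language.{u, v}) :
    (∀ (Γ : Set (FreeLogic.IForm L)) (A : FreeLogic.IForm L),
      FreeLogic.IProv Γ A →
        FreeLogic.DProv (FreeLogic.upsilon '' Γ) (FreeLogic.upsilon A)) ∧
    (∀ (Γ : Set (FreeLogic.DForm L)) (A : FreeLogic.DForm L),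
      FreeLogic.DProv Γ A →
        FreeLogic.IProv (FreeLogic.tau '' Γ) (FreeLogic.tau A)) := by
  exact ⟨fun _ _ h => h.upsilon, fun _ _ h => h.tau⟩
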